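/- Let $L_{\mathrm{res},\iota}$ be the three-sorted first-order language with sorts for a field $K$, a residue field $k$ (both with the ring symbols $0,1,+,-,\cdot$) and a value group with infinity $\Gamma\cup\{\infty\}$ (with $0,+,\leq,\infty$), and with function symbols $v:K\to\Gamma\cup\{\infty\}$, $\pi:K\to k$, $\iota:k\to K$ and $\mathrm{res}:K\to k$. Let $\mathrm{VF}_{\mathrm{res},\iota}$ be the $L_{\mathrm{res},\iota}$-theory axiomatized by the following statements. 1. $(K,v)$ is a valued field (possibly trivially valued) with value group $\Gamma$ (an ordered abelian group, $v$ being surjective onto $\Gamma\cup\{\infty\}$) and valuation ring $\mathcal O_K=\{a\in K: v(a)\geq 0\}$; the restriction of $\pi$ to $\mathcal O_K$ is the residue map $\mathcal O_K\to k$, i.e. a surjective ring homomorphism onto the field $k$ whose kernel is the maximal ideal of $\mathcal O_K$ (and, by convention, $\pi(a)=0$ for $a\notin\mathcal O_K$); $K$ and $k$ have the same characteristic; and $\iota:k\to K$ is a field embedding with image in $\mathcal O_K$ such that $\pi\circ\iota=\mathrm{id}_k$. 2. $\mathrm{res}(a)=\pi(a)$ for all $a\in\mathcal O_K$. 3. $\mathrm{res}$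 is $k$-linear: $\mathrm{res}(\iota(\lambda)a+\iota(\mu)b)=\lambda\,\mathrm{res}(a)+\mu\,\mathrm{res}(b)$ for all $\lambda,\mu\in k$ and $a,b\in K$. A theory $T^*$ is a model companion of a theory $T$ in the same language if every model of $T$ embeds into a model of $T^*$, every model of $T^*$ embeds into a model of $T$, and $T^*$ is model-complete, i.e. every embedding between models of $T^*$ is elementary. Theorem. The theory $\mathrm{VF}_{\mathrm{res},\iota}$ does not admit a model companion. -/

import Mathlib

universe u

/-! ### Many-sorted first-order logic -/

/-- A many-sorted first-order language: a function symbol `f` takes arguments of the sorts listed in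
`dom f` to the sort `cod f`; a relation symbol `R` takes arguments of the sorts listed in
`arity R`. -/
structure MSLanguage where
  Sorts : Type
  Func : Type
  dom : Func → List Sorts
  cod : Func → Sorts
  Rel : Type
  arity : Rel → List Sorts

namespace MSLanguage

/-- `Var l s` is the type of the positions at which the sort `s` occurs in the list `l`. These are
the variables of sort `s` in the context `l`; quantifiers push a new variable in front. -/
inductive Var {S : Type} : List S → S → Type
  | zero {l : List S} {s : S} : Var (s :: l) s
  | succ {l : List S} {s t : S} : Var l s → Var (t :: l) s

/-- Tuples with one entry of the appropriate sort for each position of the list `l`. -/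
abbrev Env {S : Type} (M : S → Type u) (l : List S) : Type u :=
  ∀ s, Var l s → M s

/-- The empty tuple. -/
def Env.nil {S : Type} {M : S → Type u} : Env M []
  | _, x => nomatch x

/-- Put an entry in front of a tuple. -/
def Env.cons {S : Type} {M : S → Type u} {s : S} {l : List S} (a : M s) (ρ : Env M l) :
    Env M (s :: l)
  | _, .zero => a
  | _, .succ x => ρ _ x

/-- Terms of a given sort, with variables in the context `l`. -/
inductive Term (L : MSLanguage) (l : List L.Sorts) : L.Sorts → Type
  | var {s : L.Sorts} (x : Var l s) : Term L l s
  | app (f : L.Func) (ts : ∀ s, Var (L.dom f) s → Term L l s) : Term L l (L.cod f)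

/-- First-order formulas with free variables in the context `l`. -/
inductive Formula (L : MSLanguage) : List L.Sorts → Type
  | falsum {l : List L.Sorts} : Formula L l
  | equal {l : List L.Sorts} {s : L.Sorts} (t₁ t₂ : Term L l s) : Formula L l
  | rel {l : List L.Sorts} (R : L.Rel) (ts : ∀ s, Var (L.arity R) s → Term L l s) : Formula L l
  | imp {l : List L.Sorts} (φ ψ : Formula L l) : Formula L l
  | all {l : List L.Sorts} (s : L.Sorts) (φ : Formula L (s :: l)) : Formula L l

namespace Formula

variable {L : MSLanguage} {l : List L.Sorts}

/-- Negation. -/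
def not (φ : Formula L l) : Formula L l := φ.imp falsum

/-- Disjunction. -/
def or (φ ψ : Formula L l) : Formula L l := φ.not.imp ψ

/-- Conjunction. -/
def and (φ ψ : Formula L l) : Formula L l := (φ.imp ψ.not).not

/-- Equivalence. -/
def iff (φ ψ : Formula L l) : Formula L l := (φ.imp ψ).and (ψ.imp φ)

/-- Existential quantification over the sort `s`. -/
def ex (s : L.Sorts) (φ : Formula L (s :: l)) : Formula L l := (all s φ.not).not

end Formula

/-- Sentences: formulas without free variables. -/
abbrev Sentence (L : MSLanguage) : Type := Formula L []

/-- Theories: sets of sentences. -/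
abbrev Theory (L : MSLanguage) : Type := Set (Sentence L)

/-- Structures of a many-sorted language. -/
structure Structure (L : MSLanguage) where
  carrier : L.Sorts → Type u
  funMap : ∀ f : L.Func, Env carrier (L.dom f) → carrier (L.cod f)
  relMap : ∀ R : L.Rel, Env carrier (L.arity R) → Prop

variable {L : MSLanguage}

/-- The value of a term under an assignment. -/
def Term.realize (M : Structure.{u} L) {l : List L.Sorts} (ρ : Env M.carrier l) :
    ∀ {s : L.Sorts}, Term L l s → M.carrier s
  | _, .var x => ρ _ x
  | _, .app f ts => M.funMap f fun s i => (ts s i).realize M ρ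

/-- Tarski satisfaction of a formula under an assignment. -/
def Formula.Realize (M : Structure.{u} L) :
    ∀ {l : List L.Sorts}, Formula L l → Env M.carrier l → Prop
  | _, .falsum, _ => False
  | _, .equal t₁ t₂, ρ => t₁.realize M ρ = t₂.realize M ρ
  | _, .rel R ts, ρ => M.relMap R fun s i => (ts s i).realize M ρ
  | _, .imp φ ψ, ρ => φ.Realize M ρ → ψ.Realize M ρ
  | _, .all s φ, ρ => ∀ a : M.carrier s, φ.Realize M (Env.cons a ρ)

/-- `M` is a model of the theory `T`. -/
def Structure.Models (M : Structure.{u} L) (T : Theory L) : Prop :=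
  ∀ φ ∈ T, Formula.Realize M φ Env.nil

/-- Embeddings of structures: sortwise injective maps that commute with the function symbols, and
preserve and reflect the relation symbols. -/
structure Embedding (M N : Structure.{u} L) where
  toFun : ∀ s, M.carrier s → N.carrier s
  injective : ∀ s, Function.Injective (toFun s)
  map_fun : ∀ (f : L.Func) (xs : Env M.carrier (L.dom f)),
    toFun _ (M.funMap f xs) = N.funMap f fun s i => toFun s (xs s i)
  map_rel : ∀ (R : L.Rel) (xs : Env M.carrier (L.arity R)),
    M.relMap R xs ↔ N.relMap R fun s i => toFun s (xs s i)

/-- An embedding is elementary if it preserves and reflects the truth of all formulas. -/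
def Embedding.IsElementary {M N : Structure.{u} L} (e : Embedding M N) : Prop :=
  ∀ (l : List L.Sorts) (φ : Formula L l) (ρ : Env M.carrier l),
    φ.Realize M ρ ↔ φ.Realize N fun s x => e.toFun s (ρ s x)

/-- A theory is model-complete if all embeddings between its models are elementary. -/
def Theory.IsModelComplete (T : Theory L) : Prop :=
  ∀ M N : Structure.{u} L, M.Models T → N.Models T → ∀ e : Embedding M N, e.IsElementary

/-- `T'` is a model companion of `T`. -/
structure Theory.IsModelCompanion (T T' : Theory L) : Prop where
  embeds_left : ∀ M : Structure.{u} L, M.Models T →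
    ∃ N : Structure.{u} L, N.Models T' ∧ Nonempty (Embedding M N)
  embeds_right : ∀ M : Structure.{u} L, M.Models T' →
    ∃ N : Structure.{u} L, N.Models T ∧ Nonempty (Embedding M N)
  modelComplete : Theory.IsModelComplete.{u} T'

end MSLanguage

/-! ### The three-sorted language of valued fields with a lift and a total residue map -/

namespace ResidueForm

open MSLanguage

/-- The three sorts: the field `K`, the value group with infinity `Γ ∪ {∞}`, and the residue
field `k`. -/
inductive VSort
  | field
  | value
  | residue

/-- The function symbols. -/
inductive VFunc
  | fieldZero | fieldOne | fieldNeg | fieldAdd | fieldMul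
  | residueZero | residueOne | residueNeg | residueAdd | residueMul
  | valueZero | valueTop | valueAdd
  /-- the valuation `v : K → Γ ∪ {∞}` -/
  | val
  /-- the residue map `π`, extended by `0` outside the valuation ring -/
  | proj
  /-- the lift `ι : k → K` -/
  | lift
  /-- the total residue map `res : K → k` -/
  | res

/-- The only relation symbol is the order `≤` of `Γ ∪ {∞}`. -/
inductive VRel
  | valueLE

/-- The sorts of the arguments of the function symbols. -/
def VFunc.dom : VFunc → List VSort
  | fieldZero | fieldOne => []
  | fieldNeg => [.field]
  | fieldAdd | fieldMul => [.field, .field]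
  | residueZero | residueOne => []
  | residueNeg => [.residue]
  | residueAdd | residueMul => [.residue, .residue]
  | valueZero | valueTop => []
  | valueAdd => [.value, .value]
  | val => [.field]
  | proj => [.field]
  | lift => [.residue]
  | res => [.field]

/-- The sorts of the values of the function symbols. -/
def VFunc.cod : VFunc → VSort
  | fieldZero | fieldOne | fieldNeg | fieldAdd | fieldMul => .field
  | residueZero | residueOne | residueNeg | residueAdd | residueMul => .residue
  | valueZero | valueTop | valueAdd => .value
  | val => .value
  | proj => .residue
  | lift => .field
  | res => .residue

/-- The language of valued fields with a lift of the residue field and a total residue map. -/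
abbrev Lres : MSLanguage where
  Sorts := VSort
  Func := VFunc
  dom := VFunc.dom
  cod := VFunc.cod
  Rel := VRel
  arity := fun _ => [.value, .value]

/-- Terms of the language. -/
abbrev T (l : List VSort) (s : VSort) : Type := Term Lres l s

/-- Formulas of the language. -/
abbrev F (l : List VSort) : Type := Formula Lres l

section Terms

variable {l : List VSort} {s₀ s₁ s₂ s₃ : VSort}

/-- The variable bound by the innermost quantifier. -/
def x0 : T (s₀ :: l) s₀ := .var .zero

/-- The variable bound by the second innermost quantifier. -/
def x1 : T (s₀ :: s₁ :: l) s₁ := .var (.succ .zero)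

/-- The variable bound by the third innermost quantifier. -/
def x2 : T (s₀ :: s₁ :: s₂ :: l) s₂ := .var (.succ (.succ .zero))

/-- The variable bound by the fourth innermost quantifier. -/
def x3 : T (s₀ :: s₁ :: s₂ :: s₃ :: l) s₃ := .var (.succ (.succ (.succ .zero)))

instance : Zero (T l .field) := ⟨.app (L := Lres) .fieldZero Env.nil⟩
instance : One (T l .field) := ⟨.app (L := Lres) .fieldOne Env.nil⟩
instance : Neg (T l .field) := ⟨fun a => .app (L := Lres) .fieldNeg (Env.cons a Env.nil)⟩
instance : Add (T l .field) :=
  ⟨fun a b => .app (L := Lres) .fieldAdd (Env.cons a (Env.cons b Env.nil))⟩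
instance : Mul (T l .field) :=
  ⟨fun a b => .app (L := Lres) .fieldMul (Env.cons a (Env.cons b Env.nil))⟩

instance : Zero (T l .residue) := ⟨.app (L := Lres) .residueZero Env.nil⟩
instance : One (T l .residue) := ⟨.app (L := Lres) .residueOne Env.nil⟩
instance : Neg (T l .residue) := ⟨fun a => .app (L := Lres) .residueNeg (Env.cons a Env.nil)⟩
instance : Add (T l .residue) :=
  ⟨fun a b => .app (L := Lres) .residueAdd (Env.cons a (Env.cons b Env.nil))⟩
instance : Mul (T l .residue) :=
  ⟨fun a b => .app (L := Lres) .residueMul (Env.cons a (Env.cons b Env.nil))⟩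

instance : Zero (T l .value) := ⟨.app (L := Lres) .valueZero Env.nil⟩
instance : Top (T l .value) := ⟨.app (L := Lres) .valueTop Env.nil⟩
instance : Add (T l .value) :=
  ⟨fun a b => .app (L := Lres) .valueAdd (Env.cons a (Env.cons b Env.nil))⟩

/-- The term `v(a)`. -/
def val (a : T l .field) : T l .value := .app (L := Lres) .val (Env.cons a Env.nil)

/-- The term `π(a)`. -/
def proj (a : T l .field) : T l .residue := .app (L := Lres) .proj (Env.cons a Env.nil)

/-- The term `ι(α)`. -/
def lift (α : T l .residue) : T l .field := .app (L := Lres) .lift (Env.cons α Env.nil)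

/-- The term `res(a)`. -/
def res (a : T l .field) : T l .residue := .app (L := Lres) .res (Env.cons a Env.nil)

/-- The formula `γ ≤ δ`. -/
def le (γ δ : T l .value) : F l := .rel (L := Lres) .valueLE (Env.cons γ (Env.cons δ Env.nil))

/-- The formula `a ∈ 𝒪_K`, that is, `0 ≤ v(a)`. -/
def integral (a : T l .field) : F l := le 0 (val a)

/-- The term `1 + ⋯ + 1` with `n` summands. -/
def numeral {s : VSort} [Zero (T l s)] [One (T l s)] [Add (T l s)] : ℕ → T l s
  | 0 => 0
  | n + 1 => numeral n + 1

/-- Quantification over the field. -/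
abbrev allK (φ : F (.field :: l)) : F l := .all (L := Lres) .field φ

/-- Quantification over the values. -/
abbrev allV (φ : F (.value :: l)) : F l := .all (L := Lres) .value φ

/-- Quantification over the residue field. -/
abbrev allR (φ : F (.residue :: l)) : F l := .all (L := Lres) .residue φ

/-- Existential quantification over the field. -/
abbrev exK (φ : F (.field :: l)) : F l := .ex (L := Lres) .field φ

/-- Existential quantification over the values. -/
abbrev exV (φ : F (.value :: l)) : F l := .ex (L := Lres) .value φ

end Terms

open Formula in
/-- The axioms of fields, for one of the sorts. -/
def fieldAxioms (s : VSort) [∀ l, Zero (T l s)] [∀ l, One (T l s)] [∀ l, Neg (T l s)]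
    [∀ l, Add (T l s)] [∀ l, Mul (T l s)] : Theory Lres :=
  { all s <| all s <| all s <| equal (x2 + x1 + x0) (x2 + (x1 + x0)),
    all s <| all s <| equal (x1 + x0) (x0 + x1),
    all s <| equal (0 + x0) x0,
    all s <| equal (-x0 + x0) 0,
    all s <| all s <| all s <| equal (x2 * x1 * x0) (x2 * (x1 * x0)),
    all s <| all s <| equal (x1 * x0) (x0 * x1),
    all s <| equal (1 * x0) x0,
    all s <| all s <| all s <| equal (x2 * (x1 + x0)) (x2 * x1 + x2 * x0),
    not (equal (0 : T [] s) 1),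
    all s <| or (equal x0 0) (ex s (equal (x1 * x0) 1)) }

open Formula in
/-- The sort of values is `Γ ∪ {∞}` for an ordered abelian group `Γ`. -/
def valueAxioms : Theory Lres :=
  { allV <| le x0 x0,
    allV <| allV <| allV <| imp (le x2 x1) (imp (le x1 x0) (le x2 x0)),
    allV <| allV <| imp (le x1 x0) (imp (le x0 x1) (equal x1 x0)),
    allV <| allV <| or (le x1 x0) (le x0 x1),
    allV <| le x0 ⊤,
    allV <| allV <| allV <| equal (x2 + x1 + x0) (x2 + (x1 + x0)),
    allV <| allV <| equal (x1 + x0) (x0 + x1),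
    allV <| equal (0 + x0) x0,
    allV <| equal (⊤ + x0) ⊤,
    not (equal (0 : T [] .value) ⊤),
    allV <| or (equal x0 ⊤) (exV (equal (x1 + x0) 0)),
    allV <| allV <| allV <| imp (le x2 x1) (le (x2 + x0) (x1 + x0)) }

open Formula in
/-- `v` is a valuation of `K` with value group `Γ`. -/
def valuationAxioms : Theory Lres :=
  { allK <| iff (equal (val x0) ⊤) (equal x0 0),
    allK <| allK <| equal (val (x1 * x0)) (val x1 + val x0),
    allK <| allK <| or (le (val x1) (val (x1 + x0))) (le (val x0) (val (x1 + x0))),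
    allV <| exK <| equal (val x0) x1 }

open Formula in
/-- `π`, restricted to the valuation ring, is a surjective ring homomorphism onto `k` whose kernel
is the maximal ideal; outside the valuation ring it has the conventional value `0`. -/
def projAxioms : Theory Lres :=
  { allK <| allK <| imp (integral x1) (imp (integral x0)
      (equal (proj (x1 + x0)) (proj x1 + proj x0))),
    allK <| allK <| imp (integral x1) (imp (integral x0)
      (equal (proj (x1 * x0)) (proj x1 * proj x0))),
    equal (proj 1) (1 : T [] .residue),
    allK <| imp (integral x0) (iff (equal (proj x0) 0) (not (equal (val x0) 0))),
    allR <| exK <| and (integral x0) (equal (proj x0) x1),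
    allK <| imp (not (integral x0)) (equal (proj x0) 0) }

open Formula in
/-- `K` and `k` have the same characteristic. -/
def equalCharAxioms : Theory Lres :=
  Set.range fun n : ℕ =>
    iff (equal (numeral n : T [] .field) 0) (equal (numeral n : T [] .residue) 0)

open Formula in
/-- `ι : k → K` is a field embedding with values in the valuation ring and `π ∘ ι = id`. -/
def liftAxioms : Theory Lres :=
  { allR <| allR <| equal (lift (x1 + x0)) (lift x1 + lift x0),
    allR <| allR <| equal (lift (x1 * x0)) (lift x1 * lift x0),
    equal (lift 1) (1 : T [] .field),
    allR <| integral (lift x0),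
    allR <| equal (proj (lift x0)) x0 }

open Formula in
/-- `res` restricts to `π` on the valuation ring, and `res (λ a + μ b) = λ res a + μ res b` for
`λ, μ ∈ k` and `a, b ∈ K`, where `k` acts on `K` through `ι`. -/
def resAxioms : Theory Lres :=
  { allK <| imp (integral x0) (equal (res x0) (proj x0)),
    allR <| allR <| allK <| allK <|
      equal (res (lift x3 * x1 + lift x2 * x0)) (x3 * res x1 + x2 * res x0) }

/-- The theory of equal characteristic valued fields with a lift `ι` of the residue field and a
total residue map `res`. -/
def VFresLift : Theory Lres :=
  fieldAxioms .field ∪ fieldAxioms .residue ∪ valueAxioms ∪ valuationAxioms ∪ projAxioms ∪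
    equalCharAxioms ∪ liftAxioms ∪ resAxioms

end ResidueForm

/-!
Let `a ∈ 𝔪_K` and consider the elements `z_y = b / (ι(y) - a)` for nonzero `y ∈ k`. They satisfy
`y res(aⁿ z_y) = res(aⁿ⁺¹ z_y) + res(aⁿ b)`. Hence, if `res(aⁿ b) = 0` for all `n` and `aᵐ b` is
integral for some `m`, then `aᵐ z_y` is integral with residue `res(aᵐ b) / y = 0`, and descending
from `m` to `0` yields `res(z_y) = 0`. If however no `aⁿ b` is integral, then the `z_y` are linearly
independent over `k` modulo `𝒪_K`; when `k` is infinite, any finitely many values of `res` can thus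
be kept while `res(z_y)` is made nonzero for some `y`, and an ultraproduct of the resulting
structures is an extension in which the `res(z_y)` do not all vanish.

In `k((t))` with the constant coefficient as `res`, the pairs `(t², t⁻⁽²ᵐ⁺¹⁾)` are of the first
kind, and a nonprincipal ultraproduct of them over `m` is of the second kind. The models of a model
companion are existentially closed and stable under ultraproducts, so that in this ultraproduct all
`res(z_y)` would have to vanish, in every extension.
-/

namespace MSLanguage

universe v

variable {L : MSLanguage} {l : List L.Sorts}

/-- The tuple obtained by applying a sortwise map to all entries of a tuple. -/
abbrev Env.map {S : Type} {M : S → Type u} {N : S → Type v} (g : ∀ s, M s → N s) {l : List S}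
    (ρ : Env M l) : Env N l :=
  fun s x => g s (ρ s x)

theorem Env.eq_nil {S : Type} {M : S → Type u} (ρ : Env M []) : ρ = Env.nil := by
  funext s x
  cases x

theorem Env.eq_cons {S : Type} {M : S → Type u} {l : List S} {s : S} (ρ : Env M (s :: l)) :
    ρ = Env.cons (ρ s .zero) fun t x => ρ t x.succ := by
  funext t x
  cases x <;> rfl

theorem Env.map_cons {S : Type} {M : S → Type u} {N : S → Type v} (g : ∀ s, M s → N s)
    {l : List S} {s : S} (a : M s) (ρ : Env M l) :
    Env.map g (Env.cons a ρ) = Env.cons (g s a) (Env.map g ρ) := by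
  funext t x
  cases x <;> rfl

namespace Formula

variable {M : Structure.{u} L} {ρ : Env M.carrier l} {s : L.Sorts}

@[simp] theorem realize_equal (t₁ t₂ : Term L l s) :
    (equal t₁ t₂).Realize M ρ ↔ t₁.realize M ρ = t₂.realize M ρ :=
  Iff.rfl

@[simp] theorem realize_imp (φ ψ : Formula L l) :
    (φ.imp ψ).Realize M ρ ↔ (φ.Realize M ρ → ψ.Realize M ρ) :=
  Iff.rfl

@[simp] theorem realize_all (φ : Formula L (s :: l)) :
    (all s φ).Realize M ρ ↔ ∀ a : M.carrier s, φ.Realize M (Env.cons a ρ) :=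
  Iff.rfl

@[simp] theorem realize_not (φ : Formula L l) : φ.not.Realize M ρ ↔ ¬ φ.Realize M ρ :=
  Iff.rfl

@[simp] theorem realize_or (φ ψ : Formula L l) :
    (φ.or ψ).Realize M ρ ↔ φ.Realize M ρ ∨ ψ.Realize M ρ := by
  rw [Formula.or, realize_imp, realize_not, or_iff_not_imp_left]

@[simp] theorem realize_and (φ ψ : Formula L l) :
    (φ.and ψ).Realize M ρ ↔ φ.Realize M ρ ∧ ψ.Realize M ρ := by
  rw [Formula.and, realize_not, realize_imp, realize_not, Classical.not_imp, not_not]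

@[simp] theorem realize_iff (φ ψ : Formula L l) :
    (φ.iff ψ).Realize M ρ ↔ (φ.Realize M ρ ↔ ψ.Realize M ρ) := by
  rw [Formula.iff, realize_and, realize_imp, realize_imp, ← iff_iff_implies_and_implies]

@[simp] theorem realize_ex (φ : Formula L (s :: l)) :
    (ex s φ).Realize M ρ ↔ ∃ a : M.carrier s, φ.Realize M (Env.cons a ρ) := by
  simp only [Formula.ex, realize_not, realize_all, not_forall, not_not]

/-- Formulas without quantifiers. -/
inductive IsQF : ∀ {l : List L.Sorts}, Formula L l → Prop
  | falsum {l : List L.Sorts} : IsQF (falsum : Formula L l)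
  | equal {l : List L.Sorts} {s : L.Sorts} (t₁ t₂ : Term L l s) : IsQF (equal t₁ t₂)
  | rel {l : List L.Sorts} (R : L.Rel) (ts : ∀ s, Var (L.arity R) s → Term L l s) : IsQF (rel R ts)
  | imp {l : List L.Sorts} {φ ψ : Formula L l} : IsQF φ → IsQF ψ → IsQF (φ.imp ψ)

/-- Formulas consisting of a block of universal quantifiers followed by a quantifier-free
formula. -/
inductive IsUniversal : ∀ {l : List L.Sorts}, Formula L l → Prop
  | of_isQF {l : List L.Sorts} {φ : Formula L l} : IsQF φ → IsUniversal φ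
  | all {l : List L.Sorts} {s : L.Sorts} {φ : Formula L (s :: l)} :
      IsUniversal φ → IsUniversal (φ.all s)

theorem IsQF.not {φ : Formula L l} (h : φ.IsQF) : φ.not.IsQF :=
  h.imp .falsum

theorem IsQF.and {φ ψ : Formula L l} (hφ : φ.IsQF) (hψ : ψ.IsQF) : (φ.and ψ).IsQF :=
  (hφ.imp hψ.not).not

end Formula

section Models

variable {M : Structure.{u} L}

theorem Structure.models_union {T₁ T₂ : Theory L} :
    M.Models (T₁ ∪ T₂) ↔ M.Models T₁ ∧ M.Models T₂ := by
  simp only [Structure.Models, Set.mem_union, or_imp, forall_and]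

theorem Structure.models_insert {φ : Sentence L} {T : Theory L} :
    M.Models (insert φ T) ↔ φ.Realize M Env.nil ∧ M.Models T := by
  simp only [Structure.Models, Set.mem_insert_iff, forall_eq_or_imp]

theorem Structure.models_singleton {φ : Sentence L} : M.Models {φ} ↔ φ.Realize M Env.nil := by
  simp only [Structure.Models, Set.mem_singleton_iff, forall_eq]

theorem Structure.models_range {ι : Type*} {φ : ι → Sentence L} :
    M.Models (Set.range φ) ↔ ∀ i, (φ i).Realize M Env.nil := by
  simp only [Structure.Models, Set.forall_mem_range]

end Models

namespace Embedding

variable {M N P : Structure.{u} L}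

/-- The composition of two embeddings. -/
def comp (g : Embedding N P) (f : Embedding M N) : Embedding M P where
  toFun s x := g.toFun s (f.toFun s x)
  injective s := (g.injective s).comp (f.injective s)
  map_fun F xs := by rw [f.map_fun, g.map_fun]
  map_rel R xs := (f.map_rel R xs).trans (g.map_rel R _)

theorem realize_term (e : Embedding M N) (ρ : Env M.carrier l) {s : L.Sorts} (t : Term L l s) :
    t.realize N (Env.map e.toFun ρ) = e.toFun s (t.realize M ρ) := by
  induction t with
  | var x => rfl
  | app f ts ih => simp only [Term.realize, ih, e.map_fun]

end Embedding

namespace Formula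

variable {M N : Structure.{u} L}

theorem IsQF.realize_map_iff {φ : Formula L l} (hφ : φ.IsQF) (e : Embedding M N)
    (ρ : Env M.carrier l) : φ.Realize N (Env.map e.toFun ρ) ↔ φ.Realize M ρ := by
  induction hφ with
  | falsum => rfl
  | equal t₁ t₂ => simp only [Realize, e.realize_term, (e.injective _).eq_iff]
  | rel R ts => simp only [Realize, e.realize_term, e.map_rel]
  | imp _ _ ihφ ihψ => simp only [Realize, ihφ, ihψ]

theorem IsUniversal.realize_of_realize_map {φ : Formula L l} (hφ : φ.IsUniversal)
    (e : Embedding M N) (ρ : Env M.carrier l) (h : φ.Realize N (Env.map e.toFun ρ)) :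
    φ.Realize M ρ := by
  induction hφ with
  | of_isQF hφ => exact (hφ.realize_map_iff e ρ).1 h
  | all _ ih => exact fun a => ih _ (Env.map_cons e.toFun a ρ ▸ h (e.toFun _ a))

end Formula

/-- The models of a model companion are existentially closed among the models of the theory. -/
theorem Theory.IsModelCompanion.realize_map_of_isUniversal {T T' : Theory L}
    (hT : Theory.IsModelCompanion.{u} T T') {M P : Structure.{u} L} (hM : M.Models T')
    (hP : P.Models T) (e : Embedding M P) {φ : Formula L l} (hφ : φ.IsUniversal)
    {ρ : Env M.carrier l} (h : φ.Realize M ρ) : φ.Realize P (Env.map e.toFun ρ) := by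
  obtain ⟨R, hR, ⟨f⟩⟩ := hT.embeds_left P hP
  exact hφ.realize_of_realize_map f _ ((hT.modelComplete M R hM hR (f.comp e) l φ ρ).1 h)

theorem Var.eventually_forall {S : Type} {ι : Type*} {F : Filter ι} {l : List S}
    {p : ι → ∀ s, Var l s → Prop} (h : ∀ s x, ∀ᶠ i in F, p i s x) :
    ∀ᶠ i in F, ∀ s x, p i s x := by
  induction l with
  | nil => exact .of_forall fun _ _ x => nomatch x
  | cons t l ih =>
    filter_upwards [h t .zero, ih (p := fun i s x => p i s x.succ) fun s x => h s x.succ]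
      with i h₀ hs
    rintro s (_ | x)
    exacts [h₀, hs s x]

section Ultraproduct

variable {ι : Type v} (U : Ultrafilter ι)

/-- The ultraproduct of a family of structures. The operations are computed on the representatives
`Quotient.out`, which avoids lifting functions of tuples to the quotient. -/
noncomputable def Structure.ultraproduct (M : ι → Structure.{u} L) : Structure.{max u v} L where
  carrier s := (U : Filter ι).Product fun i => (M i).carrier s
  funMap f xs := Quotient.mk _ fun i => (M i).funMap f fun s x => (xs s x).out i
  relMap R xs := ∀ᶠ i in U, (M i).relMap R fun s x => (xs s x).out i

namespace ultraproduct

variable {M : ι → Structure.{u} L} {s : L.Sorts}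

/-- The class of a family of elements in the ultraproduct. -/
def mk (a : ∀ i, (M i).carrier s) : (Structure.ultraproduct U M).carrier s :=
  Quotient.mk _ a

/-- The tuple of the ultraproduct represented by a family of tuples. -/
def tuple (ρ : ∀ i, Env (M i).carrier l) : Env (Structure.ultraproduct U M).carrier l :=
  fun s x => mk U fun i => ρ i s x

variable {U}

theorem mk_surjective : Function.Surjective (mk U : (∀ i, (M i).carrier s) → _) :=
  Quotient.mk_surjective

theorem mk_eq_mk {a b : ∀ i, (M i).carrier s} : mk U a = mk U b ↔ ∀ᶠ i in U, a i = b i :=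
  Quotient.eq

theorem eventually_out_tuple_eq (ρ : ∀ i, Env (M i).carrier l) :
    ∀ᶠ i in U, (fun s x => (tuple U ρ s x).out i) = ρ i :=
  (Var.eventually_forall fun s x => Quotient.mk_out (s := (U : Filter ι).productSetoid _)
    fun i => ρ i s x).mono
    fun _ h => funext₂ h

theorem funMap_tuple (f : L.Func) (xs : ∀ i, Env (M i).carrier (L.dom f)) :
    (Structure.ultraproduct U M).funMap f (tuple U xs) = mk U fun i => (M i).funMap f (xs i) :=
  mk_eq_mk.2 <| (eventually_out_tuple_eq xs).mono fun i h => congrArg ((M i).funMap f) h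

theorem relMap_tuple (R : L.Rel) (xs : ∀ i, Env (M i).carrier (L.arity R)) :
    (Structure.ultraproduct U M).relMap R (tuple U xs) ↔ ∀ᶠ i in U, (M i).relMap R (xs i) :=
  Filter.eventually_congr <|
    (eventually_out_tuple_eq xs).mono fun i h => iff_of_eq (congrArg ((M i).relMap R) h)

theorem tuple_cons (a : ∀ i, (M i).carrier s) (ρ : ∀ i, Env (M i).carrier l) :
    tuple U (fun i => Env.cons (a i) (ρ i)) = Env.cons (mk U a) (tuple U ρ) := by
  funext t x
  cases x <;> rfl

theorem realize_term (ρ : ∀ i, Env (M i).carrier l) (t : Term L l s) :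
    t.realize (Structure.ultraproduct U M) (tuple U ρ) = mk U fun i => t.realize (M i) (ρ i) := by
  induction t with
  | var x => rfl
  | app f ts ih =>
    simp only [Term.realize, ih]
    exact funMap_tuple f fun i s x => (ts s x).realize (M i) (ρ i)

/-- Łoś's theorem. -/
theorem realize_formula [∀ i s, Nonempty ((M i).carrier s)] (φ : Formula L l)
    (ρ : ∀ i, Env (M i).carrier l) :
    φ.Realize (Structure.ultraproduct U M) (tuple U ρ) ↔ ∀ᶠ i in U, φ.Realize (M i) (ρ i) := by
  induction φ with
  | falsum => exact Filter.eventually_const.symm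
  | equal t₁ t₂ => simp only [Formula.Realize, realize_term, mk_eq_mk]
  | rel R ts =>
    simp only [Formula.Realize, realize_term]
    exact relMap_tuple R fun i s x => (ts s x).realize (M i) (ρ i)
  | imp φ ψ ihφ ihψ => simp only [Formula.Realize, ihφ, ihψ, Ultrafilter.eventually_imp]
  | all s φ ih =>
    constructor
    · intro h
      have drinker (i : ι) : ∃ a : (M i).carrier s, φ.Realize (M i) (Env.cons a (ρ i)) →
          ∀ b, φ.Realize (M i) (Env.cons b (ρ i)) := by
        obtain h | ⟨a, ha⟩ := Classical.forall_or_exists_not fun a =>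
          φ.Realize (M i) (Env.cons a (ρ i))
        exacts [⟨Classical.arbitrary _, fun _ => h⟩, ⟨a, fun h => (ha h).elim⟩]
      choose a ha using drinker
      exact ((ih _).1 (tuple_cons a ρ ▸ h (mk U a))).mono ha
    · intro h b
      obtain ⟨b, rfl⟩ := mk_surjective b
      rw [← tuple_cons, ih]
      exact h.mono fun i hi => hi (b i)

end ultraproduct

variable {U}

theorem Structure.Models.ultraproduct {M : ι → Structure.{u} L}
    [∀ i s, Nonempty ((M i).carrier s)] {T : Theory L} (h : ∀ i, (M i).Models T) :
    (Structure.ultraproduct U M).Models T := fun φ hφ =>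
  Env.eq_nil (ultraproduct.tuple U fun i => (Env.nil : Env (M i).carrier [])) ▸
    (ultraproduct.realize_formula φ _).2 (.of_forall fun i => h i φ hφ)

variable (U) in
/-- Sortwise maps into the factors of an ultraproduct, each property of an embedding holding
eventually for every choice of elements, induce an embedding into the ultraproduct. -/
def Embedding.toUltraproduct {M : Structure.{max u v} L} {N : ι → Structure.{u} L}
    (e : ∀ i s, M.carrier s → (N i).carrier s)
    (injective : ∀ s x y, (∀ᶠ i in U, e i s x = e i s y) → x = y)
    (map_fun : ∀ f xs, ∀ᶠ i in U, e i _ (M.funMap f xs) = (N i).funMap f (Env.map (e i) xs))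
    (map_rel : ∀ R xs, ∀ᶠ i in U, M.relMap R xs ↔ (N i).relMap R (Env.map (e i) xs)) :
    Embedding M (Structure.ultraproduct U N) where
  toFun s x := ultraproduct.mk U fun i => e i s x
  injective s x y h := injective s x y (ultraproduct.mk_eq_mk.1 h)
  map_fun f xs :=
    (ultraproduct.mk_eq_mk.2 (map_fun f xs)).trans
      (ultraproduct.funMap_tuple f fun i => Env.map (e i) xs).symm
  map_rel R xs :=
    (Filter.eventually_const.symm.trans (Filter.eventually_congr (map_rel R xs))).trans
      (ultraproduct.relMap_tuple R fun i => Env.map (e i) xs).symm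

end Ultraproduct

/-- In an ultraproduct, along `F`, of a model of the model companion containing `M₀`, the class of
the `ρ m` satisfies `φ` and all `θ i`, so this ultraproduct is not existentially closed. -/
theorem Theory.not_exists_isModelCompanion {T : Theory L} {φ : Formula L l} (hφ : φ.IsUniversal)
    {I J : Type} {θ : I → Formula L l} (hθ : ∀ i, (θ i).IsQF) {M₀ : Structure.{u} L}
    [∀ s, Nonempty (M₀.carrier s)] (hM₀ : M₀.Models T) {F : Filter J} [F.NeBot]
    {ρ : J → Env M₀.carrier l} (hθρ : ∀ i, ∀ᶠ m in F, (θ i).Realize M₀ (ρ m))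
    (hφρ : ∀ m (N : Structure.{u} L), N.Models T → ∀ e : Embedding M₀ N,
      φ.Realize N (Env.map e.toFun (ρ m)))
    (hext : ∀ P : Structure.{u} L, P.Models T → ∀ σ : Env P.carrier l,
      (∀ i, (θ i).Realize P σ) → ∃ Q : Structure.{u} L, Q.Models T ∧
        ∃ e : Embedding P Q, ¬ φ.Realize Q (Env.map e.toFun σ)) :
    ¬ ∃ T' : Theory L, Theory.IsModelCompanion.{u} T T' := by
  rintro ⟨T', hT'⟩
  obtain ⟨N, hN, ⟨e⟩⟩ := hT'.embeds_left M₀ hM₀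
  have (s : L.Sorts) : Nonempty (N.carrier s) := .map (e.toFun s) inferInstance
  have hφN (m : J) : φ.Realize N (Env.map e.toFun (ρ m)) := by
    obtain ⟨P, hP, ⟨f⟩⟩ := hT'.embeds_right N hN
    exact hφ.realize_of_realize_map f _ (hφρ m P hP (f.comp e))
  let U : Ultrafilter J := .of F
  let σ := ultraproduct.tuple U fun m => Env.map e.toFun (ρ m)
  have hN' : (Structure.ultraproduct U fun _ => N).Models T' := .ultraproduct fun _ => hN
  obtain ⟨P, hP, ⟨f⟩⟩ := hT'.embeds_right _ hN'
  obtain ⟨Q, hQ, g, hg⟩ := hext P hP (Env.map f.toFun σ) fun i =>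
    ((hθ i).realize_map_iff f σ).2 <| (ultraproduct.realize_formula (θ i) _).2 <|
      ((hθρ i).filter_mono (Ultrafilter.of_le F)).mono fun m h => ((hθ i).realize_map_iff e _).2 h
  exact hg <| hT'.realize_map_of_isUniversal hN' hQ (g.comp f) hφ <|
    (ultraproduct.realize_formula φ _).2 (.of_forall hφN)

end MSLanguage

namespace ResidueForm

/-! ### Partial fractions over a local algebra -/

section PartialFractions

open Polynomial

variable {k A V : Type*} [CommRing k] [IsDomain k] [CommRing A] [Algebra k A] [AddCommGroup V]
  [Module A V] [Module k V] [IsScalarTower k A V] {a : A} {b : V}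

theorem linearIndependent_of_sub_smul_eq (hb : ∀ q : k[X], q ≠ 0 → aeval a q • b ≠ 0)
    {ι : Type*} {y : ι → k} (hy : Function.Injective y) {z : ι → V}
    (hz : ∀ i, (algebraMap k A (y i) - a) • z i = b) : LinearIndependent k z := by
  classical
  rw [linearIndependent_iff']
  intro s g hg i hi
  -- Clearing the denominators of `∑ g i / (y i - X)` gives a polynomial annihilating `b`.
  let q : k[X] := ∑ j ∈ s, C (g j) * ∏ m ∈ s.erase j, (C (y m) - X)
  have clear_denom (j : ι) (hj : j ∈ s) :
      aeval a (∏ m ∈ s, (C (y m) - X)) • z j = aeval a (∏ m ∈ s.erase j, (C (y m) - X)) • b := by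
    rw [← Finset.prod_erase_mul _ _ hj, map_mul, mul_smul, map_sub, aeval_C, aeval_X, hz]
  have hqb : aeval a q • b = 0 := by
    calc aeval a q • b = ∑ j ∈ s, g j • aeval a (∏ m ∈ s.erase j, (C (y m) - X)) • b := by
          simp only [q, map_sum, map_mul, aeval_C, Finset.sum_smul, mul_smul, algebraMap_smul]
      _ = aeval a (∏ m ∈ s, (C (y m) - X)) • ∑ j ∈ s, g j • z j := by
          rw [Finset.smul_sum]
          exact Finset.sum_congr rfl fun j hj => by rw [← clear_denom j hj, smul_comm]
      _ = 0 := by rw [hg, smul_zero]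
  have hq : q = 0 := by_contra fun h => hb q h hqb
  have hqi : q.eval (y i) = g i * ∏ m ∈ s.erase i, (y m - y i) := by
    rw [eval_finsetSum, Finset.sum_eq_single_of_mem i hi]
    · simp [eval_prod]
    · intro j _ hji
      rw [eval_mul, eval_prod, Finset.prod_eq_zero (Finset.mem_erase.2 ⟨hji.symm, hi⟩), mul_zero]
      simp
  have hprod : ∏ m ∈ s.erase i, (y m - y i) ≠ 0 :=
    Finset.prod_ne_zero_iff.2 fun m hm => sub_ne_zero.2 (hy.ne (Finset.ne_of_mem_erase hm))
  simpa [hq, hprod] using hqi.symm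

theorem map_eq_zero_of_sub_smul_eq {f : V →ₗ[k] k} {y : k} (hy : y ≠ 0) {z : V}
    (hz : (algebraMap k A y - a) • z = b) (hb : ∀ n : ℕ, f (a ^ n • b) = 0) {m : ℕ}
    (hm : f (a ^ m • z) = 0) : f z = 0 := by
  induction m with
  | zero => simpa using hm
  | succ m ih =>
    refine ih ?_
    have : y * f (a ^ m • z) = f (a ^ (m + 1) • z) + f (a ^ m • b) := by
      rw [← smul_eq_mul, ← map_smul, ← map_add, ← hz, pow_succ, mul_smul, ← smul_add, ← add_smul,
        add_sub_cancel, algebraMap_smul, smul_comm]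
    rw [hm, hb, add_zero] at this
    exact (mul_eq_zero.1 this).resolve_left hy

end PartialFractions

section LocalAlgebra

open Polynomial

variable {k A V : Type*} [Field k] [CommRing A] [Algebra k A] [AddCommGroup V] [Module A V]
  (π : A →ₐ[k] k) [IsLocalHom π] {a : A} {b : V}

include π in
theorem isUnit_aeval_of_coeff_zero_ne_zero (ha : π a = 0) {q : k[X]} (hq : q.coeff 0 ≠ 0) :
    IsUnit (aeval a q) := by
  refine isUnit_of_map_unit π _ (IsUnit.mk0 _ ?_)
  rwa [← aeval_algHom_apply, ha, ← coeff_zero_eq_aeval_zero]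

include π in
theorem aeval_smul_ne_zero (ha : π a = 0) (hb : ∀ n : ℕ, a ^ n • b ≠ 0) {q : k[X]} (hq : q ≠ 0) :
    aeval a q • b ≠ 0 := by
  obtain ⟨r, hqr, hr⟩ := exists_eq_pow_rootMultiplicity_mul_and_not_dvd q hq 0
  rw [C_0, sub_zero] at hqr hr
  have hunit : IsUnit (aeval a r) := isUnit_aeval_of_coeff_zero_ne_zero π ha (X_dvd_iff.not.1 hr)
  rw [hqr, mul_comm, map_mul, mul_smul, map_pow, aeval_X, Ne, hunit.smul_eq_zero]
  exact hb _

end LocalAlgebra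

section Extension

variable {k V W : Type*} [DivisionRing k] [AddCommGroup V] [Module k V]
  [AddCommGroup W] [Module k W]

theorem exists_notMem_of_linearIndependent {ι : Type*} [Infinite ι] {v : ι → V}
    (hv : LinearIndependent k v) (C : Submodule k V) [FiniteDimensional k C] : ∃ i, v i ∉ C := by
  by_contra! h
  have : LinearIndependent k fun i => (⟨v i, h i⟩ : C) := .of_comp C.subtype hv
  exact not_finite_iff_infinite.2 ‹_› this.finite_of_isNoetherian

theorem exists_linearMap_eqOn_of_notMem {p : Submodule k V} {z : V} (hz : z ∉ p) (f : V →ₗ[k] W)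
    (w : W) : ∃ g : V →ₗ[k] W, Set.EqOn g f p ∧ g z = w := by
  obtain ⟨d, hdz, hdp⟩ := p.exists_le_ker_of_notMem hz
  refine ⟨f + (d.smulRight ((d z)⁻¹ • (w - f z))), fun x hx => ?_, ?_⟩
  · have : d x = 0 := hdp hx
    simp [this]
  · simp [smul_smul, hdz]

end Extension

section Quotients

variable {k A V : Type*} [Field k] [CommRing A] [Algebra k A] [AddCommGroup V] [Module A V]
  [Module k V] [IsScalarTower k A V] (π : A →ₐ[k] k) [IsLocalHom π] {a : A} {b : V}

include π in
theorem exists_notMem_sup_of_sub_smul_eq (ha : π a = 0) {N : Submodule A V}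
    (hb : ∀ n : ℕ, a ^ n • b ∉ N) {ι : Type*} [Infinite ι] {y : ι → k}
    (hy : Function.Injective y) {z : ι → V} (hz : ∀ i, (algebraMap k A (y i) - a) • z i = b)
    (C : Submodule k V) [FiniteDimensional k C] : ∃ i, z i ∉ N.restrictScalars k ⊔ C := by
  let q : V →ₗ[k] V ⧸ N := N.mkQ.restrictScalars k
  have hq : LinearIndependent k (q ∘ z) := by
    refine linearIndependent_of_sub_smul_eq (A := A) (a := a) (b := N.mkQ b) (fun p hp => ?_) hy
      fun i => ?_
    · refine aeval_smul_ne_zero π ha (fun n => ?_) hp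
      rw [← map_smul, Submodule.mkQ_apply, Ne, Submodule.Quotient.mk_eq_zero]
      exact hb n
    · exact (N.mkQ.map_smul _ _).symm.trans (congrArg N.mkQ (hz i))
  obtain ⟨i, hi⟩ := exists_notMem_of_linearIndependent hq (C.map q)
  refine ⟨i, fun h => hi ?_⟩
  obtain ⟨x, hx, c, hc, hxc⟩ := Submodule.mem_sup.1 h
  refine ⟨c, hc, ?_⟩
  rw [Function.comp_apply, ← hxc, map_add, right_eq_add]
  exact (Submodule.Quotient.mk_eq_zero N).2 hx

theorem map_eq_zero_of_pow_smul_mem_range {o : A →ₗ[A] V} {f : V →ₗ[k] k}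
    (hf : ∀ x, f (o x) = π x) (ha : π a = 0) {y : k} (hy : y ≠ 0) {z : V}
    (hz : (algebraMap k A y - a) • z = b) (hb : ∀ n : ℕ, f (a ^ n • b) = 0) {m : ℕ}
    (hm : a ^ m • b ∈ o.range) : f z = 0 := by
  have hu : IsUnit (algebraMap k A y - a) :=
    isUnit_of_map_unit π _ (by simpa [ha] using IsUnit.mk0 y hy)
  obtain ⟨u, hu⟩ := hu
  obtain ⟨x, hx⟩ := hm
  have hzx : a ^ m • z = o (↑u⁻¹ * x) := by
    rw [← smul_eq_mul, map_smul, hx, ← hz, ← hu, smul_comm (a ^ m), smul_smul, u.inv_mul, one_smul]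
  refine map_eq_zero_of_sub_smul_eq hy hz hb (m := m) ?_
  rw [hzx, hf, map_mul, ← hf x, hx, hb, mul_zero]

end Quotients

/-! ### The models of `VFresLift` -/

open MSLanguage

section Operations

variable (M : Structure.{u} Lres)

/-- The field sort of a structure. -/
abbrev FieldSort : Type u := M.carrier VSort.field

/-- The sort of values of a structure. -/
abbrev ValueSort : Type u := M.carrier VSort.value

/-- The residue sort of a structure. -/
abbrev ResidueSort : Type u := M.carrier VSort.residue

variable {M}

instance : Zero (FieldSort M) := ⟨M.funMap VFunc.fieldZero Env.nil⟩
instance : One (FieldSort M) := ⟨M.funMap VFunc.fieldOne Env.nil⟩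
instance : Neg (FieldSort M) := ⟨fun a => M.funMap VFunc.fieldNeg (Env.cons a Env.nil)⟩
instance : Add (FieldSort M) :=
  ⟨fun a b => M.funMap VFunc.fieldAdd (Env.cons a (Env.cons b Env.nil))⟩
instance : Mul (FieldSort M) :=
  ⟨fun a b => M.funMap VFunc.fieldMul (Env.cons a (Env.cons b Env.nil))⟩

instance : Zero (ResidueSort M) := ⟨M.funMap VFunc.residueZero Env.nil⟩
instance : One (ResidueSort M) := ⟨M.funMap VFunc.residueOne Env.nil⟩
instance : Neg (ResidueSort M) := ⟨fun a => M.funMap VFunc.residueNeg (Env.cons a Env.nil)⟩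
instance : Add (ResidueSort M) :=
  ⟨fun a b => M.funMap VFunc.residueAdd (Env.cons a (Env.cons b Env.nil))⟩
instance : Mul (ResidueSort M) :=
  ⟨fun a b => M.funMap VFunc.residueMul (Env.cons a (Env.cons b Env.nil))⟩

instance : Zero (ValueSort M) := ⟨M.funMap VFunc.valueZero Env.nil⟩
instance : Top (ValueSort M) := ⟨M.funMap VFunc.valueTop Env.nil⟩
instance : Add (ValueSort M) :=
  ⟨fun a b => M.funMap VFunc.valueAdd (Env.cons a (Env.cons b Env.nil))⟩
instance : LE (ValueSort M) :=
  ⟨fun a b => M.relMap VRel.valueLE (Env.cons a (Env.cons b Env.nil))⟩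

instance : ∀ s, Nonempty (M.carrier s)
  | .field => ⟨(0 : FieldSort M)⟩
  | .residue => ⟨(0 : ResidueSort M)⟩
  | .value => ⟨(0 : ValueSort M)⟩

/-- The interpretation of the symbol `v`. -/
def valMap (a : FieldSort M) : ValueSort M := M.funMap VFunc.val (Env.cons a Env.nil)

/-- The interpretation of the symbol `π`. -/
def projMap (a : FieldSort M) : ResidueSort M := M.funMap VFunc.proj (Env.cons a Env.nil)

/-- The interpretation of the symbol `ι`. -/
def liftMap (c : ResidueSort M) : FieldSort M := M.funMap VFunc.lift (Env.cons c Env.nil)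

/-- The interpretation of the symbol `res`. -/
def resMap (a : FieldSort M) : ResidueSort M := M.funMap VFunc.res (Env.cons a Env.nil)

section Realize

variable {l : List VSort} (ρ : Env M.carrier l)

theorem realize_nil : Env.map (fun _ t => Term.realize M ρ t) (Env.nil : Env (T l) []) = Env.nil :=
  Env.eq_nil _

theorem realize_singleton {s : VSort} (t : T l s) :
    Env.map (fun _ t => Term.realize M ρ t) (Env.cons (M := T l) t Env.nil) =
      Env.cons (t.realize M ρ) Env.nil := by
  rw [Env.map_cons, realize_nil]

theorem realize_pair {s s' : VSort} (t : T l s) (t' : T l s') :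
    Env.map (fun _ t => Term.realize M ρ t) (Env.cons (M := T l) t (Env.cons t' Env.nil)) =
      Env.cons (t.realize M ρ) (Env.cons (t'.realize M ρ) Env.nil) := by
  rw [Env.map_cons, realize_singleton]

@[simp] theorem realize_field_zero : Term.realize M ρ (0 : T l .field) = (0 : FieldSort M) :=
  congrArg (M.funMap VFunc.fieldZero) (realize_nil ρ)

@[simp] theorem realize_field_one : Term.realize M ρ (1 : T l .field) = (1 : FieldSort M) :=
  congrArg (M.funMap VFunc.fieldOne) (realize_nil ρ)

@[simp] theorem realize_field_neg (a : T l .field) :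
    Term.realize M ρ (-a) = -(a.realize M ρ : FieldSort M) :=
  congrArg (M.funMap VFunc.fieldNeg) (realize_singleton ρ a)

@[simp] theorem realize_field_add (a b : T l .field) :
    Term.realize M ρ (a + b) = (a.realize M ρ : FieldSort M) + b.realize M ρ :=
  congrArg (M.funMap VFunc.fieldAdd) (realize_pair ρ a b)

@[simp] theorem realize_field_mul (a b : T l .field) :
    Term.realize M ρ (a * b) = (a.realize M ρ : FieldSort M) * b.realize M ρ :=
  congrArg (M.funMap VFunc.fieldMul) (realize_pair ρ a b)

@[simp] theorem realize_residue_zero : Term.realize M ρ (0 : T l .residue) = (0 : ResidueSort M) :=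
  congrArg (M.funMap VFunc.residueZero) (realize_nil ρ)

@[simp] theorem realize_residue_one : Term.realize M ρ (1 : T l .residue) = (1 : ResidueSort M) :=
  congrArg (M.funMap VFunc.residueOne) (realize_nil ρ)

@[simp] theorem realize_residue_neg (a : T l .residue) :
    Term.realize M ρ (-a) = -(a.realize M ρ : ResidueSort M) :=
  congrArg (M.funMap VFunc.residueNeg) (realize_singleton ρ a)

@[simp] theorem realize_residue_add (a b : T l .residue) :
    Term.realize M ρ (a + b) = (a.realize M ρ : ResidueSort M) + b.realize M ρ :=
  congrArg (M.funMap VFunc.residueAdd) (realize_pair ρ a b)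

@[simp] theorem realize_residue_mul (a b : T l .residue) :
    Term.realize M ρ (a * b) = (a.realize M ρ : ResidueSort M) * b.realize M ρ :=
  congrArg (M.funMap VFunc.residueMul) (realize_pair ρ a b)

@[simp] theorem realize_value_zero : Term.realize M ρ (0 : T l .value) = (0 : ValueSort M) :=
  congrArg (M.funMap VFunc.valueZero) (realize_nil ρ)

@[simp] theorem realize_value_top : Term.realize M ρ (⊤ : T l .value) = (⊤ : ValueSort M) :=
  congrArg (M.funMap VFunc.valueTop) (realize_nil ρ)

@[simp] theorem realize_value_add (a b : T l .value) :
    Term.realize M ρ (a + b) = (a.realize M ρ : ValueSort M) + b.realize M ρ :=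
  congrArg (M.funMap VFunc.valueAdd) (realize_pair ρ a b)

@[simp] theorem realize_val (a : T l .field) :
    Term.realize M ρ (val a) = valMap (a.realize M ρ) :=
  congrArg (M.funMap VFunc.val) (realize_singleton ρ a)

@[simp] theorem realize_proj (a : T l .field) :
    Term.realize M ρ (proj a) = projMap (a.realize M ρ) :=
  congrArg (M.funMap VFunc.proj) (realize_singleton ρ a)

@[simp] theorem realize_lift (a : T l .residue) :
    Term.realize M ρ (lift a) = liftMap (a.realize M ρ) :=
  congrArg (M.funMap VFunc.lift) (realize_singleton ρ a)

@[simp] theorem realize_res (a : T l .field) :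
    Term.realize M ρ (res a) = resMap (a.realize M ρ) :=
  congrArg (M.funMap VFunc.res) (realize_singleton ρ a)

@[simp] theorem realize_le (a b : T l .value) :
    (le a b).Realize M ρ ↔ (a.realize M ρ : ValueSort M) ≤ b.realize M ρ :=
  iff_of_eq (congrArg (M.relMap VRel.valueLE) (realize_pair ρ a b))

@[simp] theorem realize_integral (a : T l .field) :
    (integral a).Realize M ρ ↔ (0 : ValueSort M) ≤ valMap (a.realize M ρ) := by
  rw [integral, realize_le, realize_value_zero, realize_val]

@[simp] theorem realize_field_numeral (n : ℕ) :
    Term.realize M ρ (numeral n : T l .field) = (Nat.unaryCast n : FieldSort M) := by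
  induction n with
  | zero => exact realize_field_zero ρ
  | succ n ih => rw [numeral, realize_field_add, ih, realize_field_one, Nat.unaryCast]

@[simp] theorem realize_residue_numeral (n : ℕ) :
    Term.realize M ρ (numeral n : T l .residue) = (Nat.unaryCast n : ResidueSort M) := by
  induction n with
  | zero => exact realize_residue_zero ρ
  | succ n ih => rw [numeral, realize_residue_add, ih, realize_residue_one, Nat.unaryCast]

end Realize

end Operations

section Laws

/-- The field axioms, for a type with operations. -/
structure FieldLaws (K : Type*) [Zero K] [One K] [Neg K] [Add K] [Mul K] : Prop where
  add_assoc : ∀ a b c : K, a + b + c = a + (b + c)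
  add_comm : ∀ a b : K, a + b = b + a
  zero_add : ∀ a : K, 0 + a = a
  neg_add : ∀ a : K, -a + a = 0
  mul_assoc : ∀ a b c : K, a * b * c = a * (b * c)
  mul_comm : ∀ a b : K, a * b = b * a
  one_mul : ∀ a : K, 1 * a = a
  mul_add : ∀ a b c : K, a * (b + c) = a * b + a * c
  zero_ne_one : (0 : K) ≠ 1
  exists_mul_eq_one : ∀ a : K, a = 0 ∨ ∃ b, a * b = 1

/-- The axioms of ordered abelian groups with infinity, for a type with operations. -/
structure ValueLaws (Γ : Type*) [Zero Γ] [Top Γ] [Add Γ] [LE Γ] : Prop where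
  le_refl : ∀ γ : Γ, γ ≤ γ
  le_trans : ∀ γ δ ε : Γ, γ ≤ δ → δ ≤ ε → γ ≤ ε
  le_antisymm : ∀ γ δ : Γ, γ ≤ δ → δ ≤ γ → γ = δ
  le_total : ∀ γ δ : Γ, γ ≤ δ ∨ δ ≤ γ
  le_top : ∀ γ : Γ, γ ≤ ⊤
  add_assoc : ∀ γ δ ε : Γ, γ + δ + ε = γ + (δ + ε)
  add_comm : ∀ γ δ : Γ, γ + δ = δ + γ
  zero_add : ∀ γ : Γ, 0 + γ = γ
  top_add : ∀ γ : Γ, ⊤ + γ = ⊤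
  zero_ne_top : (0 : Γ) ≠ ⊤
  exists_add_eq_zero : ∀ γ : Γ, γ = ⊤ ∨ ∃ δ, γ + δ = 0
  add_le_add_right : ∀ γ δ ε : Γ, γ ≤ δ → γ + ε ≤ δ + ε

variable {K Γ k : Type*} [Zero K] [One K] [Add K] [Mul K] [Zero Γ] [Top Γ] [Add Γ] [LE Γ]
  [Zero k] [One k] [Add k] [Mul k]

/-- The axioms on the valuation, the residue map `π` and the lift `ι` of the residue field. -/
structure ValuedLaws (v : K → Γ) (π : K → k) (ι : k → K) : Prop where
  val_eq_top : ∀ a, v a = ⊤ ↔ a = 0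
  val_mul : ∀ a b, v (a * b) = v a + v b
  val_add : ∀ a b, v a ≤ v (a + b) ∨ v b ≤ v (a + b)
  val_surjective : ∀ γ, ∃ a, v a = γ
  proj_add : ∀ a b, 0 ≤ v a → 0 ≤ v b → π (a + b) = π a + π b
  proj_mul : ∀ a b, 0 ≤ v a → 0 ≤ v b → π (a * b) = π a * π b
  proj_one : π 1 = 1
  proj_eq_zero : ∀ a, 0 ≤ v a → (π a = 0 ↔ v a ≠ 0)
  proj_surjective : ∀ c, ∃ a, 0 ≤ v a ∧ π a = c
  proj_of_not_integral : ∀ a, ¬ 0 ≤ v a → π a = 0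
  natCast_eq_zero : ∀ n : ℕ, (Nat.unaryCast n : K) = 0 ↔ (Nat.unaryCast n : k) = 0
  lift_add : ∀ c d, ι (c + d) = ι c + ι d
  lift_mul : ∀ c d, ι (c * d) = ι c * ι d
  lift_one : ι 1 = 1
  integral_lift : ∀ c, 0 ≤ v (ι c)
  proj_lift : ∀ c, π (ι c) = c

/-- The axioms on the total residue map `r`. -/
structure ResLaws (v : K → Γ) (π : K → k) (ι : k → K) (r : K → k) : Prop where
  res_eq_proj : ∀ a, 0 ≤ v a → r a = π a
  res_linear : ∀ c d a b, r (ι c * a + ι d * b) = c * r a + d * r b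

end Laws

/-- The axioms of `VFresLift` for a structure `M`, expressed by the operations on its sorts. -/
class IsModel (M : Structure.{u} Lres) : Prop where
  fieldLaws : FieldLaws (FieldSort M)
  residueLaws : FieldLaws (ResidueSort M)
  valueLaws : ValueLaws (ValueSort M)
  valuedLaws : ValuedLaws (valMap (M := M)) projMap liftMap
  resLaws : ResLaws (valMap (M := M)) projMap liftMap resMap

section Axioms

variable {M : Structure.{u} Lres}

open Structure Formula

theorem models_fieldAxioms_field :
    M.Models (fieldAxioms .field) ↔ FieldLaws (FieldSort M) := by
  rw [fieldAxioms]
  iterate 9 rw [models_insert]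
  rw [models_singleton]
  simp only [realize_all, realize_equal, realize_not, realize_or, realize_ex, realize_field_zero,
    realize_field_one, realize_field_neg, realize_field_add, realize_field_mul]
  exact ⟨fun ⟨h₁, h₂, h₃, h₄, h₅, h₆, h₇, h₈, h₉, h₁₀⟩ => ⟨h₁, h₂, h₃, h₄, h₅, h₆, h₇, h₈, h₉, h₁₀⟩,
    fun ⟨h₁, h₂, h₃, h₄, h₅, h₆, h₇, h₈, h₉, h₁₀⟩ => ⟨h₁, h₂, h₃, h₄, h₅, h₆, h₇, h₈, h₉, h₁₀⟩⟩

theorem models_fieldAxioms_residue :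
    M.Models (fieldAxioms .residue) ↔ FieldLaws (ResidueSort M) := by
  rw [fieldAxioms]
  iterate 9 rw [models_insert]
  rw [models_singleton]
  simp only [realize_all, realize_equal, realize_not, realize_or, realize_ex, realize_residue_zero,
    realize_residue_one, realize_residue_neg, realize_residue_add, realize_residue_mul]
  exact ⟨fun ⟨h₁, h₂, h₃, h₄, h₅, h₆, h₇, h₈, h₉, h₁₀⟩ => ⟨h₁, h₂, h₃, h₄, h₅, h₆, h₇, h₈, h₉, h₁₀⟩,
    fun ⟨h₁, h₂, h₃, h₄, h₅, h₆, h₇, h₈, h₉, h₁₀⟩ => ⟨h₁, h₂, h₃, h₄, h₅, h₆, h₇, h₈, h₉, h₁₀⟩⟩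

theorem models_valueAxioms : M.Models valueAxioms ↔ ValueLaws (ValueSort M) := by
  rw [valueAxioms]
  iterate 11 rw [models_insert]
  rw [models_singleton]
  simp only [realize_all, realize_equal, realize_not, realize_or, realize_imp, realize_ex,
    realize_le, realize_value_zero, realize_value_top, realize_value_add]
  exact ⟨fun ⟨h₁, h₂, h₃, h₄, h₅, h₆, h₇, h₈, h₉, h₁₀, h₁₁, h₁₂⟩ =>
      ⟨h₁, h₂, h₃, h₄, h₅, h₆, h₇, h₈, h₉, h₁₀, h₁₁, h₁₂⟩,
    fun ⟨h₁, h₂, h₃, h₄, h₅, h₆, h₇, h₈, h₉, h₁₀, h₁₁, h₁₂⟩ =>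
      ⟨h₁, h₂, h₃, h₄, h₅, h₆, h₇, h₈, h₉, h₁₀, h₁₁, h₁₂⟩⟩

theorem models_valuedAxioms :
    M.Models (valuationAxioms ∪ projAxioms ∪ equalCharAxioms ∪ liftAxioms) ↔
      ValuedLaws (valMap (M := M)) projMap liftMap := by
  rw [models_union, models_union, models_union, valuationAxioms, projAxioms, equalCharAxioms,
    models_range, liftAxioms]
  iterate 12 rw [models_insert]
  iterate 3 rw [models_singleton]
  simp only [realize_all, realize_equal, realize_not, realize_or, realize_and, realize_imp,
    realize_iff, realize_ex, realize_le, realize_integral, realize_field_zero, realize_field_one,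
    realize_field_add, realize_field_mul, realize_residue_zero, realize_residue_one,
    realize_residue_add, realize_residue_mul, realize_value_zero, realize_value_top,
    realize_value_add, realize_val, realize_proj, realize_lift, realize_field_numeral,
    realize_residue_numeral, and_assoc]
  exact ⟨fun ⟨h₁, h₂, h₃, h₄, h₅, h₆, h₇, h₈, h₉, h₁₀, h₁₁, h₁₂, h₁₃, h₁₄, h₁₅, h₁₆⟩ =>
      ⟨h₁, h₂, h₃, h₄, h₅, h₆, h₇, h₈, h₉, h₁₀, h₁₁, h₁₂, h₁₃, h₁₄, h₁₅, h₁₆⟩,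
    fun ⟨h₁, h₂, h₃, h₄, h₅, h₆, h₇, h₈, h₉, h₁₀, h₁₁, h₁₂, h₁₃, h₁₄, h₁₅, h₁₆⟩ =>
      ⟨h₁, h₂, h₃, h₄, h₅, h₆, h₇, h₈, h₉, h₁₀, h₁₁, h₁₂, h₁₃, h₁₄, h₁₅, h₁₆⟩⟩

theorem models_resAxioms :
    M.Models resAxioms ↔ ResLaws (valMap (M := M)) projMap liftMap resMap := by
  rw [resAxioms, models_insert, models_singleton]
  simp only [realize_all, realize_equal, realize_imp, realize_integral, realize_field_add,
    realize_field_mul, realize_residue_add, realize_residue_mul, realize_proj, realize_lift,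
    realize_res]
  exact ⟨fun ⟨h₁, h₂⟩ => ⟨h₁, h₂⟩, fun ⟨h₁, h₂⟩ => ⟨h₁, h₂⟩⟩

theorem models_VFresLift : M.Models VFresLift ↔ IsModel M := by
  rw [VFresLift, Set.union_assoc _ equalCharAxioms]
  trans FieldLaws (FieldSort M) ∧ FieldLaws (ResidueSort M) ∧ ValueLaws (ValueSort M) ∧
    ValuedLaws (valMap (M := M)) projMap liftMap ∧ ResLaws (valMap (M := M)) projMap liftMap resMap
  · rw [← models_fieldAxioms_field, ← models_fieldAxioms_residue, ← models_valueAxioms,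
      ← models_valuedAxioms, ← models_resAxioms]
    simp only [models_union, and_assoc]
  · exact ⟨fun ⟨h₁, h₂, h₃, h₄, h₅⟩ => ⟨h₁, h₂, h₃, h₄, h₅⟩,
      fun ⟨h₁, h₂, h₃, h₄, h₅⟩ => ⟨h₁, h₂, h₃, h₄, h₅⟩⟩

end Axioms

section Model

theorem unaryCast_eq_natCast {R : Type*} [AddMonoidWithOne R] (n : ℕ) :
    (Nat.unaryCast n : R) = n := by
  induction n with
  | zero => exact Nat.cast_zero.symm
  | succ n ih => rw [Nat.unaryCast, ih, Nat.cast_succ]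

/-- The field given by operations that satisfy the field axioms. -/
noncomputable abbrev FieldLaws.toField {K : Type*} [Zero K] [One K] [Neg K] [Add K] [Mul K]
    (h : FieldLaws K) : Field K :=
  haveI := Classical.decEq K
  letI : Inv K :=
    ⟨fun a => if ha : a = 0 then 0 else ((h.exists_mul_eq_one a).resolve_left ha).choose⟩
  Field.ofMinimalAxioms K h.add_assoc h.zero_add h.neg_add h.mul_assoc h.mul_comm h.one_mul
    (fun a ha =>
      (congrArg (a * ·) (dif_neg ha)).trans ((h.exists_mul_eq_one a).resolve_left ha).choose_spec)
    (dif_pos rfl) h.mul_add ⟨0, 1, h.zero_ne_one⟩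

variable {M : Structure.{u} Lres} [hM : IsModel M]

noncomputable instance : Field (FieldSort M) := hM.fieldLaws.toField

noncomputable instance : Field (ResidueSort M) := hM.residueLaws.toField

noncomputable instance : Algebra (ResidueSort M) (FieldSort M) :=
  RingHom.toAlgebra <| .mk' ⟨⟨liftMap, hM.valuedLaws.lift_one⟩, hM.valuedLaws.lift_mul⟩
    hM.valuedLaws.lift_add

theorem liftMap_eq_algebraMap (c : ResidueSort M) :
    liftMap c = algebraMap (ResidueSort M) (FieldSort M) c := rfl

theorem valMap_mul_nonneg {a b : FieldSort M} (ha : 0 ≤ valMap a) (hb : 0 ≤ valMap b) :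
    0 ≤ valMap (a * b) := by
  have h := hM.valueLaws
  have hab := h.add_le_add_right _ _ (valMap b) ha
  rw [h.zero_add] at hab
  rw [hM.valuedLaws.val_mul]
  exact h.le_trans _ _ _ hb hab

theorem valMap_add_nonneg {a b : FieldSort M} (ha : 0 ≤ valMap a) (hb : 0 ≤ valMap b) :
    0 ≤ valMap (a + b) :=
  (hM.valuedLaws.val_add a b).elim (hM.valueLaws.le_trans _ _ _ ha)
    (hM.valueLaws.le_trans _ _ _ hb)

variable (M) in
/-- The valuation ring of a model, as an algebra over the residue field. -/
noncomputable def integers : Subalgebra (ResidueSort M) (FieldSort M) where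
  carrier := {a | 0 ≤ valMap a}
  mul_mem' := valMap_mul_nonneg
  add_mem' := valMap_add_nonneg
  algebraMap_mem' := hM.valuedLaws.integral_lift

variable (M) in
/-- The valuation ring of a model, as a submodule of the field over the valuation ring. -/
noncomputable abbrev integersRange : Submodule (integers M) (FieldSort M) :=
  (Algebra.linearMap (integers M) (FieldSort M)).range

theorem mem_integersRange {a : FieldSort M} : a ∈ integersRange M ↔ 0 ≤ valMap a :=
  ⟨fun ⟨x, hx⟩ => hx ▸ x.2, fun h => ⟨⟨a, h⟩, rfl⟩⟩

variable (M) in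
/-- The residue map of a model, as a homomorphism on the valuation ring. -/
noncomputable def projHom : integers M →ₐ[ResidueSort M] ResidueSort M :=
  { RingHom.mk' ⟨⟨fun x : integers M => projMap (M := M) x, hM.valuedLaws.proj_one⟩,
      fun x y => hM.valuedLaws.proj_mul x y x.2 y.2⟩
      fun x y => hM.valuedLaws.proj_add x y x.2 y.2 with
    commutes' := hM.valuedLaws.proj_lift }

theorem ne_zero_of_valMap_eq_zero {a : FieldSort M} (ha : valMap a = 0) : a ≠ 0 := fun h =>
  hM.valueLaws.zero_ne_top (ha.symm.trans ((hM.valuedLaws.val_eq_top a).2 h))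

theorem valMap_inv_nonneg {a : FieldSort M} (ha : valMap a = 0) : 0 ≤ valMap a⁻¹ := by
  rw [← hM.valueLaws.zero_add (valMap a⁻¹), ← ha, ← hM.valuedLaws.val_mul,
    mul_inv_cancel₀ (ne_zero_of_valMap_eq_zero ha), ha]
  exact one_mem (integers M)

instance : IsLocalHom (projHom M) where
  map_nonunit x hx := by
    have hval : valMap x.1 = 0 :=
      not_not.1 ((hM.valuedLaws.proj_eq_zero x x.2).not.1 hx.ne_zero)
    exact .of_mul_eq_one ⟨x.1⁻¹, valMap_inv_nonneg hval⟩
      (Subtype.ext (mul_inv_cancel₀ (ne_zero_of_valMap_eq_zero hval)))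

variable (M) in
/-- The total residue map of a model, as a linear map over the residue field. -/
noncomputable def resHom : FieldSort M →ₗ[ResidueSort M] ResidueSort M where
  toFun := resMap
  map_add' a b := by
    simpa [liftMap_eq_algebraMap] using hM.resLaws.res_linear 1 1 a b
  map_smul' c a := by
    simpa [liftMap_eq_algebraMap, Algebra.smul_def] using hM.resLaws.res_linear c 0 a 0

theorem infinite_residueSort (h : ∀ n : ℕ, (Nat.unaryCast (n + 1) : ResidueSort M) ≠ 0) :
    Infinite (ResidueSort M) := by
  have : CharZero (ResidueSort M) :=
    charZero_of_inj_zero fun n hn => by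
      cases n with
      | zero => rfl
      | succ n => exact (h n ((unaryCast_eq_natCast _).trans hn)).elim
  infer_instance

end Model

/-! ### The residues of `b / (ι(y) - a)` -/

section Formulas

/-- The term `aⁿ`. -/
def pow {l : List VSort} (a : T l .field) : ℕ → T l .field
  | 0 => 1
  | n + 1 => pow a n * a

/-- The formula `a ∈ 𝔪_K`; the free variables of the formulas below are `a` and `b`. -/
def infinitesimal : F [.field, .field] := .and (integral x0) (.equal (proj x0) 0)

/-- The formula `aⁿ b ∈ 𝒪_K`. -/
def integralPowMul (n : ℕ) : F [.field, .field] := integral (pow x0 n * x1)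

/-- The formula `res(aⁿ b) = 0`. -/
def resPowMulEqZero (n : ℕ) : F [.field, .field] := .equal (res (pow x0 n * x1)) 0

/-- The formula saying that `res(b / (ι(y) - a)) = 0` for all nonzero `y ∈ k`. -/
def resVanishes : F [.field, .field] :=
  allR <| allK <| .imp (.not (.equal x1 0)) <|
    .imp (.equal ((lift x1 + -x2) * x0) x3) (.equal (res x0) 0)

/-- The formula saying that `n + 1 ≠ 0` in the residue field. -/
def residueSuccNeZero (n : ℕ) : F [.field, .field] :=
  .not (.equal (numeral (n + 1) : T [.field, .field] .residue) 0)

/-- The `n`-th formula of the type of the pairs `(a, b)` with `a ∈ 𝔪_K` and `v(b) < -n v(a)` for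
all `n`, over a residue field of characteristic zero. -/
def infinitelyBelow (n : ℕ) : F [.field, .field] :=
  .and infinitesimal (.and (.not (integralPowMul n)) (residueSuccNeZero n))

theorem isQF_infinitesimal : infinitesimal.IsQF := .and (.rel _ _) (.equal _ _)

theorem isQF_integralPowMul (n : ℕ) : (integralPowMul n).IsQF := .rel _ _

theorem isQF_resPowMulEqZero (n : ℕ) : (resPowMulEqZero n).IsQF := .equal _ _

theorem isQF_infinitelyBelow (n : ℕ) : (infinitelyBelow n).IsQF :=
  isQF_infinitesimal.and ((isQF_integralPowMul n).not.and (.not (.equal _ _)))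

theorem isUniversal_resVanishes : resVanishes.IsUniversal :=
  .all <| .all <| .of_isQF <| .imp (.not (.equal _ _)) (.imp (.equal _ _) (.equal _ _))

variable {M : Structure.{u} Lres} [hM : IsModel M] {l : List VSort} {ρ : Env M.carrier l}

@[simp] theorem realize_pow (a : T l .field) (n : ℕ) :
    Term.realize M ρ (pow a n) = (a.realize M ρ : FieldSort M) ^ n := by
  induction n with
  | zero => exact realize_field_one ρ
  | succ n ih => rw [pow, realize_field_mul, ih, pow_succ]

theorem realize_resVanishes {ρ : Env M.carrier [.field, .field]} :
    resVanishes.Realize M ρ ↔ ∀ (y : ResidueSort M) (z : FieldSort M), y ≠ 0 →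
      (algebraMap _ (FieldSort M) y - x0.realize M ρ) * z = x1.realize M ρ → resHom M z = 0 := by
  simp only [resVanishes, Formula.realize_all, Formula.realize_imp, Formula.realize_not,
    Formula.realize_equal, realize_field_mul, realize_field_add, realize_field_neg, realize_lift,
    realize_res, realize_residue_zero, sub_eq_add_neg]
  rfl

theorem realize_resVanishes_of_integralPowMul {ρ : Env M.carrier [.field, .field]}
    (ha : infinitesimal.Realize M ρ) (hb : ∀ n, (resPowMulEqZero n).Realize M ρ) {m : ℕ}
    (hm : (integralPowMul m).Realize M ρ) : resVanishes.Realize M ρ := by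
  simp only [infinitesimal, resPowMulEqZero, integralPowMul, Formula.realize_and,
    Formula.realize_equal, realize_integral, realize_proj, realize_res, realize_field_mul,
    realize_pow, realize_residue_zero] at ha hb hm
  rw [realize_resVanishes]
  intro y z hy hz
  exact map_eq_zero_of_pow_smul_mem_range (projHom M)
    (o := Algebra.linearMap (integers M) (FieldSort M)) (f := resHom M)
    (a := ⟨_, ha.1⟩) (fun x => hM.resLaws.res_eq_proj x x.2) ha.2 hy hz hb
    (mem_integersRange.2 hm)

theorem realize_resVanishes_of_embedding {M N : Structure.{u} Lres} [IsModel N] (e : Embedding M N)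
    {ρ : Env M.carrier [.field, .field]} (ha : infinitesimal.Realize M ρ)
    (hb : ∀ n, (resPowMulEqZero n).Realize M ρ) {m : ℕ} (hm : (integralPowMul m).Realize M ρ) :
    resVanishes.Realize N (Env.map e.toFun ρ) :=
  realize_resVanishes_of_integralPowMul ((isQF_infinitesimal.realize_map_iff e ρ).2 ha)
    (fun n => ((isQF_resPowMulEqZero n).realize_map_iff e ρ).2 (hb n))
    (((isQF_integralPowMul m).realize_map_iff e ρ).2 hm)

end Formulas

section ChangeOfRes

/-- The structure `M` with the symbol `res` interpreted by `f`. -/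
def withRes (M : Structure.{u} Lres) (f : FieldSort M → ResidueSort M) : Structure.{u} Lres where
  carrier := M.carrier
  funMap
    | .res => fun xs => f (xs .field .zero)
    | g => M.funMap g
  relMap := M.relMap

variable {M : Structure.{u} Lres}

theorem IsModel.withRes [hM : IsModel M] {f : FieldSort M →ₗ[ResidueSort M] ResidueSort M}
    (hf : ∀ a, 0 ≤ valMap a → f a = resHom M a) : IsModel (withRes M f) where
  fieldLaws := hM.fieldLaws
  residueLaws := hM.residueLaws
  valueLaws := hM.valueLaws
  valuedLaws := hM.valuedLaws
  resLaws.res_eq_proj a ha := (hf a ha).trans (hM.resLaws.res_eq_proj a ha)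
  resLaws.res_linear c d a b := by
    refine (f.map_add _ _).trans (congrArg₂ _ ?_ ?_)
    · exact f.map_smul c a
    · exact f.map_smul d b

/-- The diagonal embedding into an ultraproduct of structures that differ from `M` in the
interpretation of `res`, when each value of `res` is eventually the one in `M`. -/
def embeddingWithRes {ι : Type u} (U : Ultrafilter ι) {f : ι → FieldSort M → ResidueSort M}
    (hf : ∀ a, ∀ᶠ i in U, resMap a = f i a) :
    Embedding M (Structure.ultraproduct U fun i => withRes M (f i)) :=
  .toUltraproduct U (fun _ _ x => x) (fun _ _ _ h => Filter.eventually_const.1 h)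
    (fun g xs => by
      cases g with
      | res =>
        refine (hf (xs .field .zero)).mono fun i hi => Eq.trans ?_ hi
        exact congrArg (M.funMap VFunc.res) ((Env.eq_cons xs).trans (congrArg _ (Env.eq_nil _)))
      | _ => exact .of_forall fun _ => rfl)
    fun _ _ => .of_forall fun _ => Iff.rfl

theorem exists_resHom_not_realize_resVanishes [hM : IsModel M] [Infinite (ResidueSort M)]
    {ρ : Env M.carrier [.field, .field]} (ha : infinitesimal.Realize M ρ)
    (hb : ∀ n, ¬ (integralPowMul n).Realize M ρ) (C : Finset (FieldSort M)) :
    ∃ f : FieldSort M →ₗ[ResidueSort M] ResidueSort M, (∀ a, 0 ≤ valMap a → f a = resHom M a) ∧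
      (∀ a ∈ C, f a = resHom M a) ∧ ¬ resVanishes.Realize (withRes M f) ρ := by
  simp only [infinitesimal, integralPowMul, Formula.realize_and, Formula.realize_equal,
    realize_integral, realize_proj, realize_field_mul, realize_pow, realize_residue_zero, ←
    mem_integersRange] at ha hb
  let a : integers M := ⟨x0.realize M ρ, mem_integersRange.1 ha.1⟩
  let z (y : {y : ResidueSort M // y ≠ 0}) : FieldSort M :=
    x1.realize M ρ / (algebraMap (ResidueSort M) (FieldSort M) y - x0.realize M ρ)
  have hz (y) : (algebraMap _ (FieldSort M) y.1 - x0.realize M ρ) * z y = x1.realize M ρ :=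
    mul_div_cancel₀ _ <| sub_ne_zero.2 fun h => y.2 <|
      ((projHom M).commutes y.1).symm.trans <|
        (congrArg (projHom M) (Subtype.ext h : algebraMap _ _ y.1 = a)).trans ha.2
  have : Infinite {y : ResidueSort M // y ≠ 0} := (Set.finite_singleton 0).infinite_compl.to_subtype
  obtain ⟨y, hy⟩ := exists_notMem_sup_of_sub_smul_eq (projHom M) (a := a) ha.2 hb
    Subtype.val_injective hz (.span _ C)
  obtain ⟨f, hf, hfz⟩ := exists_linearMap_eqOn_of_notMem hy (resHom M) 1
  have hf₀ (x : FieldSort M) (hx : 0 ≤ valMap x) : f x = resHom M x :=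
    hf (Submodule.mem_sup_left (mem_integersRange.2 hx))
  refine ⟨f, hf₀, fun x hx => hf (Submodule.mem_sup_right (Submodule.subset_span hx)), fun h => ?_⟩
  have := (realize_resVanishes (hM := .withRes hf₀)).1 h y.1 (z y) y.2 (hz y)
  exact one_ne_zero (α := ResidueSort M) (hfz.symm.trans this)

theorem exists_embedding_not_realize_resVanishes [hM : IsModel M] [Infinite (ResidueSort M)]
    {ρ : Env M.carrier [.field, .field]} (ha : infinitesimal.Realize M ρ)
    (hb : ∀ n, ¬ (integralPowMul n).Realize M ρ) :
    ∃ N : Structure.{u} Lres, N.Models VFresLift ∧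
      ∃ e : Embedding M N, ¬ resVanishes.Realize N (Env.map e.toFun ρ) := by
  choose f hf hfC hfρ using exists_resHom_not_realize_resVanishes ha hb
  let U : Ultrafilter (Finset (FieldSort M)) := .of Filter.atTop
  have hU (x : FieldSort M) : ∀ᶠ C in U, resMap x = f C x :=
    (Filter.eventually_atTop.2 ⟨{x}, fun C hC => (hfC C x (hC (Finset.mem_singleton_self x))).symm⟩
      : ∀ᶠ C in Filter.atTop, _).filter_mono (Ultrafilter.of_le _)
  have hN (C) : IsModel (withRes M (f C)) := .withRes (hf C)
  refine ⟨_, .ultraproduct fun C => models_VFresLift.2 (hN C), embeddingWithRes U hU, fun h => ?_⟩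
  exact ((ultraproduct.realize_formula (M := fun C => withRes M (f C)) resVanishes
    fun _ => ρ).1 h).exists.elim hfρ

theorem exists_embedding_of_infinitelyBelow {M : Structure.{u} Lres} (hM : M.Models VFresLift)
    {ρ : Env M.carrier [.field, .field]} (h : ∀ n, (infinitelyBelow n).Realize M ρ) :
    ∃ N : Structure.{u} Lres, N.Models VFresLift ∧
      ∃ e : Embedding M N, ¬ resVanishes.Realize N (Env.map e.toFun ρ) := by
  have := models_VFresLift.1 hM
  simp only [infinitelyBelow, residueSuccNeZero, Formula.realize_and, Formula.realize_not,
    Formula.realize_equal, realize_residue_numeral, realize_residue_zero, forall_and, forall_const]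
    at h
  have := infinite_residueSort h.2.2
  exact exists_embedding_not_realize_resVanishes h.1 h.2.1

end ChangeOfRes

/-! ### Fields of Hahn series -/

section OfAddValuation

theorem fieldLaws_of_field (K : Type*) [Field K] : FieldLaws K where
  add_assoc := add_assoc
  add_comm := add_comm
  zero_add := zero_add
  neg_add := neg_add_cancel
  mul_assoc := mul_assoc
  mul_comm := mul_comm
  one_mul := one_mul
  mul_add := mul_add
  zero_ne_one := zero_ne_one
  exists_mul_eq_one a := or_iff_not_imp_left.2 fun ha => ⟨a⁻¹, mul_inv_cancel₀ ha⟩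

theorem valueLaws_of_linearOrderedAddCommGroupWithTop (Γ : Type*)
    [LinearOrderedAddCommGroupWithTop Γ] : ValueLaws Γ where
  le_refl := le_refl
  le_trans _ _ _ := le_trans
  le_antisymm _ _ := le_antisymm
  le_total := le_total
  le_top _ := le_top
  add_assoc := add_assoc
  add_comm := add_comm
  zero_add := zero_add
  top_add := top_add
  zero_ne_top := LinearOrderedAddCommGroupWithTop.zero_ne_top
  exists_add_eq_zero γ := or_iff_not_imp_left.2 fun hγ =>
    ⟨-γ, LinearOrderedAddCommGroupWithTop.add_neg_cancel_of_ne_top hγ⟩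
  add_le_add_right _ _ ε h := add_le_add_left h ε

variable {K Γ k : Type u} [Field K] [LinearOrderedAddCommGroupWithTop Γ] [Field k] [Algebra k K]

/-- A linear map `r : K → k` which restricts to a residue map of the valuation ring of `v`, of
which `k` is then a subfield of representatives of the residues. -/
structure IsTotalResidueMap (v : AddValuation K Γ) (r : K →ₗ[k] k) : Prop where
  algebraMap_nonneg : ∀ c : k, 0 ≤ v (algebraMap k K c)
  res_one : r 1 = 1
  res_mul : ∀ a b, 0 ≤ v a → 0 ≤ v b → r (a * b) = r a * r b
  res_eq_zero_iff : ∀ a, 0 ≤ v a → (r a = 0 ↔ v a ≠ 0)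

open Classical in
/-- The structure given by a valuation `v` of a field extension of `k` and a map `r : K → k`. -/
noncomputable def ofAddValuation (v : AddValuation K Γ) (r : K → k) : Structure.{u} Lres where
  carrier
    | .field => K
    | .residue => k
    | .value => Γ
  funMap
    | .fieldZero => fun _ => (0 : K)
    | .fieldOne => fun _ => (1 : K)
    | .fieldNeg => fun xs => -(xs .field .zero : K)
    | .fieldAdd => fun xs => (xs .field .zero + xs .field (.succ .zero) : K)
    | .fieldMul => fun xs => (xs .field .zero * xs .field (.succ .zero) : K)
    | .residueZero => fun _ => (0 : k)
    | .residueOne => fun _ => (1 : k)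
    | .residueNeg => fun xs => -(xs .residue .zero : k)
    | .residueAdd => fun xs => (xs .residue .zero + xs .residue (.succ .zero) : k)
    | .residueMul => fun xs => (xs .residue .zero * xs .residue (.succ .zero) : k)
    | .valueZero => fun _ => (0 : Γ)
    | .valueTop => fun _ => (⊤ : Γ)
    | .valueAdd => fun xs => (xs .value .zero + xs .value (.succ .zero) : Γ)
    | .val => fun xs => v (xs .field .zero)
    | .proj => fun xs => if 0 ≤ v (xs .field .zero) then r (xs .field .zero) else (0 : k)
    | .lift => fun xs => algebraMap k K (xs .residue .zero)
    | .res => fun xs => r (xs .field .zero)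
  relMap
    | .valueLE => fun xs => (xs .value .zero : Γ) ≤ xs .value (.succ .zero)

variable {v : AddValuation K Γ} {r : K →ₗ[k] k}

theorem IsTotalResidueMap.res_algebraMap (h : IsTotalResidueMap v r) (c : k) :
    r (algebraMap k K c) = c := by
  rw [Algebra.algebraMap_eq_smul_one, map_smul, h.res_one, smul_eq_mul, mul_one]

open Classical in
theorem IsTotalResidueMap.valuedLaws (h : IsTotalResidueMap v r)
    (hv : Function.Surjective v) :
    ValuedLaws v (fun a => if 0 ≤ v a then r a else 0) (algebraMap k K) where
  val_eq_top _ := v.top_iff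
  val_mul := v.map_mul
  val_add a b := min_le_iff.1 (v.map_add a b)
  val_surjective := hv
  proj_add a b ha hb := by
    rw [if_pos ha, if_pos hb, if_pos (v.map_le_add ha hb), map_add]
  proj_mul a b ha hb := by
    rw [if_pos ha, if_pos hb, if_pos (v.map_mul a b ▸ add_nonneg ha hb), h.res_mul a b ha hb]
  proj_one := (if_pos v.map_one.ge).trans h.res_one
  proj_eq_zero a ha := by rw [if_pos ha, h.res_eq_zero_iff a ha]
  proj_surjective c :=
    ⟨algebraMap k K c, h.algebraMap_nonneg c,
      (if_pos (h.algebraMap_nonneg c)).trans (h.res_algebraMap c)⟩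
  proj_of_not_integral _ ha := if_neg ha
  natCast_eq_zero n := by
    rw [unaryCast_eq_natCast, unaryCast_eq_natCast, ← map_natCast (algebraMap k K),
      map_eq_zero]
  lift_add := map_add _
  lift_mul := map_mul _
  lift_one := map_one _
  integral_lift := h.algebraMap_nonneg
  proj_lift c := (if_pos (h.algebraMap_nonneg c)).trans (h.res_algebraMap c)

theorem IsTotalResidueMap.isModel_ofAddValuation (h : IsTotalResidueMap v r)
    (hv : Function.Surjective v) : IsModel (ofAddValuation v r) where
  fieldLaws := fieldLaws_of_field K
  residueLaws := fieldLaws_of_field k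
  valueLaws := valueLaws_of_linearOrderedAddCommGroupWithTop Γ
  valuedLaws := h.valuedLaws hv
  resLaws.res_eq_proj _ ha := (if_pos ha).symm
  resLaws.res_linear c d a b := by
    refine (r.map_add _ _).trans (congrArg₂ _ ?_ ?_)
    · exact (congrArg r (Algebra.smul_def (R := k) (A := K) c a).symm).trans (r.map_smul c a)
    · exact (congrArg r (Algebra.smul_def (R := k) (A := K) d b).symm).trans (r.map_smul d b)

theorem realize_pow_ofAddValuation {l : List VSort} {ρ : Env (ofAddValuation v r).carrier l}
    (a : T l .field) (n : ℕ) :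
    Term.realize (ofAddValuation v r) ρ (pow a n) =
      (show K from a.realize (ofAddValuation v r) ρ) ^ n := by
  induction n with
  | zero => exact (realize_field_one ρ).trans (pow_zero (M := K) _).symm
  | succ n ih =>
    rw [pow, realize_field_mul, ih]
    exact (pow_succ (M := K) _ n).symm

variable {a b : K}

theorem IsTotalResidueMap.realize_infinitesimal_ofAddValuation (h : IsTotalResidueMap v r) :
    infinitesimal.Realize (ofAddValuation v r) (Env.cons a (Env.cons b Env.nil)) ↔ 0 < v a := by
  rw [infinitesimal, Formula.realize_and, realize_integral, Formula.realize_equal, realize_proj,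
    realize_residue_zero]
  change 0 ≤ v a ∧ (if 0 ≤ v a then r a else 0) = 0 ↔ _
  rw [lt_iff_le_and_ne, ne_comm]
  exact and_congr_right fun ha => by rw [if_pos ha, h.res_eq_zero_iff a ha]

theorem realize_integralPowMul_ofAddValuation {n : ℕ} :
    (integralPowMul n).Realize (ofAddValuation v r) (Env.cons a (Env.cons b Env.nil)) ↔
      0 ≤ v (a ^ n * b) := by
  rw [integralPowMul, realize_integral, realize_field_mul, realize_pow_ofAddValuation]
  rfl

theorem realize_resPowMulEqZero_ofAddValuation {n : ℕ} :
    (resPowMulEqZero n).Realize (ofAddValuation v r) (Env.cons a (Env.cons b Env.nil)) ↔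
      r (a ^ n * b) = 0 := by
  rw [resPowMulEqZero, Formula.realize_equal, realize_res, realize_field_mul,
    realize_pow_ofAddValuation, realize_residue_zero]
  rfl

theorem realize_residueSuccNeZero_ofAddValuation [CharZero k] (n : ℕ)
    (ρ : Env (ofAddValuation v r).carrier [.field, .field]) :
    (residueSuccNeZero n).Realize (ofAddValuation v r) ρ := by
  rw [residueSuccNeZero, Formula.realize_not, Formula.realize_equal, realize_residue_numeral,
    realize_residue_zero]
  exact (unaryCast_eq_natCast (R := k) (n + 1)).trans_ne (Nat.cast_ne_zero.2 n.succ_ne_zero)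

end OfAddValuation

section HahnSeries

open HahnSeries

variable {Γ k : Type u} [AddCommGroup Γ] [LinearOrder Γ] [IsOrderedAddMonoid Γ] [Field k]

theorem orderTop_sub_C_coeff_zero_pos {x : HahnSeries Γ k} (hx : 0 ≤ x.orderTop) :
    0 < (x - C (x.coeff 0)).orderTop := by
  have h₀ : (x - C (x.coeff 0)).coeff 0 = 0 := by
    rw [coeff_sub, C_apply, coeff_single_same, sub_self]
  refine lt_of_le_of_ne ((le_min hx orderTop_single_le).trans min_orderTop_le_orderTop_sub) ?_
  exact fun h => coeff_orderTop_ne h.symm h₀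

theorem coeff_zero_mul {x y : HahnSeries Γ k} (hx : 0 ≤ x.orderTop) (hy : 0 ≤ y.orderTop) :
    (x * y).coeff 0 = x.coeff 0 * y.coeff 0 := by
  have h : ((x - C (x.coeff 0)) * y).coeff 0 = 0 := by
    refine coeff_eq_zero_of_lt_orderTop ?_
    rw [orderTop_mul]
    exact add_pos_of_pos_of_nonneg (orderTop_sub_C_coeff_zero_pos hx) hy
  rwa [sub_mul, coeff_sub, sub_eq_zero, C_mul_eq_smul, coeff_smul, smul_eq_mul] at h

theorem isTotalResidueMap_coeff_zero :
    IsTotalResidueMap (addVal Γ k) (coeff.linearMap (R := k) 0) where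
  algebraMap_nonneg c := by
    rw [addVal_apply]
    exact orderTop_single_le
  res_one := coeff_single_same 0 1
  res_mul _ _ := coeff_zero_mul
  res_eq_zero_iff x hx :=
    ⟨fun h hx₀ => coeff_orderTop_ne (g := 0) hx₀ h,
      fun h => coeff_eq_zero_of_lt_orderTop (lt_of_le_of_ne hx (Ne.symm h))⟩

theorem addVal_surjective : Function.Surjective (addVal Γ k) := by
  rintro (_ | γ)
  exacts [⟨0, orderTop_zero⟩, ⟨single γ 1, orderTop_single one_ne_zero⟩]

variable (Γ k) in
/-- The field `k((t^Γ))` with its valuation, the constants as lift of the residue field, and the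
constant coefficient as total residue map. -/
noncomputable def hahnModel : Structure.{u} Lres :=
  ofAddValuation (addVal Γ k) (coeff.linearMap (R := k) 0)

instance : IsModel (hahnModel Γ k) :=
  isTotalResidueMap_coeff_zero.isModel_ofAddValuation addVal_surjective

variable (k) in
/-- The pair `(t^(2γ), t^(-(2m+1)γ))`. -/
noncomputable def monomialPair (γ : Γ) (m : ℕ) : Env (hahnModel Γ k).carrier [.field, .field] :=
  Env.cons (single ((2 : ℤ) • γ) (1 : k) : HahnSeries Γ k)
    (Env.cons (single (-(2 * m + 1 : ℤ) • γ) (1 : k) : HahnSeries Γ k) Env.nil)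

theorem single_pow_mul_single (γ : Γ) (n m : ℕ) :
    (single ((2 : ℤ) • γ) (1 : k) ^ n * single (-(2 * m + 1 : ℤ) • γ) 1 : HahnSeries Γ k) =
      single ((2 * (n - m) - 1 : ℤ) • γ) 1 := by
  rw [single_pow, single_mul_single, one_pow, one_mul, ← natCast_zsmul, smul_smul, ← add_smul]
  ring_nf

variable {γ : Γ}

theorem realize_infinitesimal_monomialPair (hγ : 0 < γ) (m : ℕ) :
    infinitesimal.Realize (hahnModel Γ k) (monomialPair k γ m) := by
  refine isTotalResidueMap_coeff_zero.realize_infinitesimal_ofAddValuation.2 ?_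
  rw [addVal_apply, orderTop_single one_ne_zero]
  exact WithTop.coe_pos.2 (zsmul_pos hγ two_pos)

theorem realize_integralPowMul_monomialPair (hγ : 0 < γ) (m n : ℕ) :
    (integralPowMul n).Realize (hahnModel Γ k) (monomialPair k γ m) ↔ m < n := by
  refine realize_integralPowMul_ofAddValuation.trans ?_
  rw [single_pow_mul_single, addVal_apply, orderTop_single one_ne_zero, WithTop.coe_nonneg,
    ← zero_smul ℤ γ, (zsmul_left_strictMono hγ).le_iff_le]
  lia

theorem realize_resPowMulEqZero_monomialPair (hγ : 0 < γ) (m n : ℕ) :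
    (resPowMulEqZero n).Realize (hahnModel Γ k) (monomialPair k γ m) := by
  refine realize_resPowMulEqZero_ofAddValuation.2 ?_
  rw [single_pow_mul_single]
  refine coeff_single_of_ne ?_
  rw [← zero_smul ℤ γ, (zsmul_left_strictMono hγ).injective.ne_iff]
  lia

theorem eventually_realize_infinitelyBelow_monomialPair [CharZero k] (hγ : 0 < γ) (n : ℕ) :
    ∀ᶠ m in Filter.atTop, (infinitelyBelow n).Realize (hahnModel Γ k) (monomialPair k γ m) := by
  filter_upwards [Filter.eventually_ge_atTop n] with m hm
  simp only [infinitelyBelow, Formula.realize_and, Formula.realize_not]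
  exact ⟨realize_infinitesimal_monomialPair hγ m,
    (realize_integralPowMul_monomialPair hγ m n).not.2 hm.not_gt,
    realize_residueSuccNeZero_ofAddValuation n _⟩

end HahnSeries

end ResidueForm

open MSLanguage ResidueForm in
/-- The theory of equal characteristic valued fields with a lift of the residue field and a total
residue map has no model companion. (The universe `u` of the models is arbitrary.) -/
theorem mainTheorem1 :
    ¬ ∃ T : MSLanguage.Theory ResidueForm.Lres,
      MSLanguage.Theory.IsModelCompanion.{u} ResidueForm.VFresLift T := by
  have hγ : (0 : ULift.{u} ℤ) < ULift.up 1 := one_pos (α := ℤ)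
  have : IsOrderedAddMonoid (ULift.{u} ℤ) :=
    Function.Injective.isOrderedAddMonoid ULift.down (fun _ _ => rfl) Iff.rfl
  have : CharZero (ULift.{u} ℚ) :=
    ⟨fun _ _ h => Nat.cast_injective (R := ℚ) (congrArg ULift.down h)⟩
  refine Theory.not_exists_isModelCompanion isUniversal_resVanishes isQF_infinitelyBelow
    (M₀ := hahnModel (ULift ℤ) (ULift ℚ)) (models_VFresLift.2 inferInstance)
    (eventually_realize_infinitelyBelow_monomialPair hγ) (fun m N hN e => ?_)
    fun P hP σ hσ => exists_embedding_of_infinitelyBelow hP hσ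
  have := models_VFresLift.1 hN
  exact realize_resVanishes_of_embedding e (realize_infinitesimal_monomialPair hγ m)
    (realize_resPowMulEqZero_monomialPair hγ m)
    ((realize_integralPowMul_monomialPair hγ m (m + 1)).2 m.lt_succ_self)
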